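/- Let $p\ge 3$ and $k\ge\max(1,6-p)$ be integers. For integers $d>r\ge0$ let $\mathcal S^{d,r}_k$ be the space of splines on $[0,1]$ of degree $d$ and regularity $r$ over $k$ segments of equal length (functions of class $C^r$ that are polynomials of degree at most $d$ on each $[\frac jk,\frac{j+1}k]$). For $d\ge1$ let $\theta^d_i$ ($0\le i\le 2k+d-2$) and $\eta^d_i$ ($0\le i\le k+d-1$) be the Greville abscissae $\frac1d(\xi_{i+1}+\dots+\xi_{i+d})$ of the knot vectors $(\xi_m)$ with end knots $0$ and $1$, each repeated $d+1$ times, and interior knots $\frac1k,\dots,\frac{k-1}k$, each taken twice (for $\theta^d$) or once (for $\eta^d$). Let $Q$ be a convex non-degenerate quadrilateral (all interior angles strictly between $0$ and $\pi$) with vertices $v_1,\dots,v_4$ in counter-clockwise order, edges $e_i$ from $v_i$ to $v_{i+1}$ (indices modulo 4), a unit normal $n_i$ of each edge (of either direction), and bilinear parametrization $$F(\xi_1,\xi_2)=(1-\xi_1)(1-\xi_2)v_1+\xi_1(1-\xi_2)v_2+\xi_1\xi_2v_3+(1-\xi_1)\xi_2v_4,\qquad (\xi_1,\xi_2)\in[0,1]^2.$$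 Let $F_{e_i}$ be the restriction of $F$ to the edge of $[0,1]^2$ that is mapped to $e_i$, viewed as a function on $[0,1]$ with $F_{e_i}(0)=v_i$, $F_{e_i}(1)=v_{i+1}$. Let $S_Q$ be the set of all $\varphi:\overline Q\to\mathbb R$ such that $\varphi\circ F\in\mathcal S^{p,p-2}_k\otimes\mathcal S^{p,p-2}_k$ and, for $i=1,\dots,4$, $$\varphi\circ F_{e_i}\in\mathcal S^{p,p-1}_k,\qquad (\partial_{n_i}\varphi)\circ F_{e_i}\in\mathcal S^{p-1,p-2}_k .$$ Derivatives at points of $\partial Q$ are taken relative to $\overline Q$. Let $\Lambda_Q$ consist of the degrees of freedom * $\varphi,\ \partial_1\varphi,\ \partial_2\varphi,\ \partial_1\partial_1\varphi,\ \partial_1\partial_2\varphi,\ \partial_2\partial_2\varphi$ at $v_i$, for $1\le i\le4$; * $\varphi(F_{e_i}(\eta^p_{j+2}))$ for $1\le i\le 4$, $1\le j\le k+p-6$; * $\partial_{n_i}\varphi(F_{e_i}(\eta^{p-1}_{j+1}))$ for $1\le i\le4$, $1\le j\le k+p-5$; * $\varphi(F(\theta^p_{j_1},\theta^p_{j_2}))$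 for $2\le j_1,j_2\le 2k+p-4$. Then $\Lambda_Q$ completely determines $S_Q$ (unisolvence): $S_Q$ is a linear space, the elements of $\Lambda_Q$ are linear functionals on it, and for every choice of real values for the degrees of freedom there is exactly one $\varphi\in S_Q$ that attains them. -/

import Mathlib

namespace SplineElement

open Set

/-! ### Univariate and tensor-product splines on `[0,1]` -/

/-- The univariate spline space of degree `p` and regularity `r` on `[0,1]`, split into `k` segments
of equal length: the functions that are of class `C^r` on `[0,1]` and coincide with a polynomial of
degree at most `p` on each segment `[j/k, (j+1)/k]`. Only the values on `[0,1]` matter. -/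
def splineSpace (p r k : ℕ) : Submodule ℝ (ℝ → ℝ) where
  carrier := {f | ContDiffOn ℝ r f (Icc 0 1) ∧
    ∀ j < k, ∃ P : Polynomial ℝ, P.natDegree ≤ p ∧
      ∀ x ∈ Icc ((j : ℝ) / k) (((j : ℝ) + 1) / k), f x = P.eval x}
  add_mem' := by
    rintro f g ⟨hf, hf'⟩ ⟨hg, hg'⟩
    refine ⟨hf.add hg, fun j hj => ?_⟩
    obtain ⟨P, hP, hPf⟩ := hf' j hj
    obtain ⟨R, hR, hRg⟩ := hg' j hj
    refine ⟨P + R, (Polynomial.natDegree_add_le P R).trans (max_le hP hR), fun x hx => ?_⟩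
    simp [hPf x hx, hRg x hx]
  zero_mem' := ⟨contDiffOn_const, fun _ _ => ⟨0, by simp, by simp⟩⟩
  smul_mem' := by
    rintro c f ⟨hf, hf'⟩
    refine ⟨hf.const_smul c, fun j hj => ?_⟩
    obtain ⟨P, hP, hPf⟩ := hf' j hj
    refine ⟨c • P, (Polynomial.natDegree_smul_le c P).trans hP, fun x hx => ?_⟩
    simp [hPf x hx]

/-- The tensor-product spline space `S ⊗ S`, with `S` the univariate spline space: the span of the
products `f(ξ₁) g(ξ₂)`. -/
def tensorSplineSpace (p r k : ℕ) : Submodule ℝ (ℝ × ℝ → ℝ) :=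
  Submodule.span ℝ {s | ∃ f ∈ splineSpace p r k, ∃ g ∈ splineSpace p r k,
    s = fun ξ => f ξ.1 * g ξ.2}

/-- The entry with index `m = 0, 1, 2, …` of the open knot vector of degree `p` on `[0,1]` with
interior knots `1/k, …, (k-1)/k`, each repeated `μ` times, and end knots `0` and `1`, each
repeated `p + 1` times. (The entries past the end of the knot vector are `1` and are never used;
the inner division is the integer division.) -/
noncomputable def knot (p μ k m : ℕ) : ℝ :=
  if m ≤ p then 0 else min 1 ((((m - p - 1) / μ + 1 : ℕ) : ℝ) / k)

/-- The Greville abscissa `γ_i = (ξ_{i+1} + ⋯ + ξ_{i+p}) / p` of this knot vector. -/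
noncomputable def greville (p μ k i : ℕ) : ℝ :=
  (∑ j ∈ Finset.Icc 1 p, knot p μ k (i + j)) / p

/-- Greville abscissae `θ_i^p` for degree `p` and regularity `p - 2` (double interior knots). -/
noncomputable def theta (p k i : ℕ) : ℝ := greville p 2 k i

/-- Greville abscissae `η_i^p` for degree `p` and regularity `p - 1` (simple interior knots). -/
noncomputable def eta (p k i : ℕ) : ℝ := greville p 1 k i

/-! ### Bilinear quadrilaterals -/

/-- The plane with coordinates `(x₁, x₂)`, here `(x 0, x 1)`. -/
abbrev Plane := EuclideanSpace ℝ (Fin 2)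

/-- The determinant of two plane vectors. -/
def det₂ (a b : Plane) : ℝ := a 0 * b 1 - a 1 * b 0

/-- The edge vector from the `i`-th vertex to the next one (indices modulo `4`). -/
def edgeVec (v : Fin 4 → Plane) (i : Fin 4) : Plane := v (i + 1) - v i

/-- A convex non-degenerate quadrilateral, given by its four vertices in counter-clockwise order:
at every vertex the boundary polygon turns strictly to the left, that is, every interior angle
lies strictly between `0` and `π`. -/
structure Quadrilateral where
  /-- the vertices, in counter-clockwise order -/
  vertex : Fin 4 → Plane
  /-- all interior angles lie strictly between `0` and `π` -/
  convex_ccw : ∀ i, 0 < det₂ (edgeVec vertex (i - 1)) (edgeVec vertex i)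

namespace Quadrilateral

variable (Q : Quadrilateral)

/-- The closed quadrilateral. -/
def closedSet : Set Plane := convexHull ℝ (range Q.vertex)

/-- The bilinear parametrization of the closed quadrilateral over `[0,1]²`. -/
noncomputable def param (ξ : ℝ × ℝ) : Plane :=
  ((1 - ξ.1) * (1 - ξ.2)) • Q.vertex 0 + (ξ.1 * (1 - ξ.2)) • Q.vertex 1
    + (ξ.1 * ξ.2) • Q.vertex 2 + ((1 - ξ.1) * ξ.2) • Q.vertex 3

end Quadrilateral

/-- The edges of the parameter square `[0,1]²`, traversed counter-clockwise for `t ∈ [0,1]`. -/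
def refEdge (i : Fin 4) (t : ℝ) : ℝ × ℝ :=
  ![(t, 0), (1, t), (1 - t, 1), (0, 1 - t)] i

namespace Quadrilateral

variable (Q : Quadrilateral)

/-- The restriction of the bilinear parametrization to the `i`-th edge. -/
noncomputable def edgeParam (i : Fin 4) (t : ℝ) : Plane := Q.param (refEdge i t)

/-- `n i` is a unit normal vector of the `i`-th edge (of either direction). -/
def IsUnitNormals (n : Fin 4 → Plane) : Prop :=
  ∀ i, ‖n i‖ = 1 ∧ inner ℝ (n i) (edgeVec Q.vertex i) = 0

/-- A function on the closed quadrilateral, written as a function on the plane (extended by zero).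
Only its values on the closed quadrilateral, and its derivatives relative to it, are used. -/
noncomputable def ext (φ : Q.closedSet → ℝ) : Plane → ℝ :=
  Function.extend Subtype.val φ 0

/-- The derivative of `g` at `x` in direction `u`, relative to the closed quadrilateral
(hence one-sided at its boundary). -/
noncomputable def dirDeriv (u : Plane) (g : Plane → ℝ) (x : Plane) : ℝ :=
  fderivWithin ℝ g Q.closedSet x u

/-- The partial derivative `∂_{x_{a+1}}` relative to the closed quadrilateral. -/
noncomputable def partialDeriv (a : Fin 2) (g : Plane → ℝ) : Plane → ℝ :=
  Q.dirDeriv (EuclideanSpace.single a 1) g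

/-- The local space of the `C¹` quadrilateral spline macro-element of degree `p` with `k × k` split:
the pullback is a tensor-product spline of degree `p` and regularity `p - 2`, its trace on each edge
is a spline of degree `p` and regularity `p - 1`, and the pullback of the normal derivative on each
edge is a spline of degree `p - 1` and regularity `p - 2`. -/
def localSpace (n : Fin 4 → Plane) (p k : ℕ) : Set (Q.closedSet → ℝ) :=
  {φ | (∃ s ∈ tensorSplineSpace p (p - 2) k,
          ∀ ξ ∈ Icc (0 : ℝ) 1 ×ˢ Icc (0 : ℝ) 1, Q.ext φ (Q.param ξ) = s ξ) ∧
    ∀ i : Fin 4,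
      (fun t => Q.ext φ (Q.edgeParam i t)) ∈ splineSpace p (p - 1) k ∧
      (fun t => Q.dirDeriv (n i) (Q.ext φ) (Q.edgeParam i t)) ∈ splineSpace (p - 1) (p - 2) k}

end Quadrilateral

/-- Labels of the degrees of freedom. -/
inductive Dof (p k : ℕ) : Type where
  /-- the `m`-th `C²` datum at the `i`-th vertex -/
  | vertex (i : Fin 4) (m : Fin 6)
  /-- point evaluations on the `i`-th edge -/
  | edgeValue (i : Fin 4) (j : Fin (k + p - 6))
  /-- normal derivatives on the `i`-th edge -/
  | edgeNormal (i : Fin 4) (j : Fin (k + p - 5))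
  /-- point evaluations at the face points -/
  | face (j₁ j₂ : Fin (2 * k + p - 5))

namespace Quadrilateral

variable (Q : Quadrilateral)

/-- The values of the degrees of freedom at `φ`. The indices start from `0`, so that `j` stands for
`j₀ = j + 1`, `j₁ = j + 1` on the edges (abscissae `η^p_{j₀+2}` and `η^{p-1}_{j₁+1}`), and for
`j + 2` at the face points. -/
noncomputable def dofValue (n : Fin 4 → Plane) {p k : ℕ} (φ : Q.closedSet → ℝ) : Dof p k → ℝ
  | .vertex i m =>
      ![Q.ext φ (Q.vertex i),
        Q.partialDeriv 0 (Q.ext φ) (Q.vertex i),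
        Q.partialDeriv 1 (Q.ext φ) (Q.vertex i),
        Q.partialDeriv 0 (Q.partialDeriv 0 (Q.ext φ)) (Q.vertex i),
        Q.partialDeriv 0 (Q.partialDeriv 1 (Q.ext φ)) (Q.vertex i),
        Q.partialDeriv 1 (Q.partialDeriv 1 (Q.ext φ)) (Q.vertex i)] m
  | .edgeValue i j => Q.ext φ (Q.edgeParam i (eta p k (j + 3)))
  | .edgeNormal i j => Q.dirDeriv (n i) (Q.ext φ) (Q.edgeParam i (eta (p - 1) k (j + 2)))
  | .face j₁ j₂ => Q.ext φ (Q.param (theta p k (j₁ + 2), theta p k (j₂ + 2)))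

end Quadrilateral

end SplineElement

/-! The pullback `s` of `φ` is a tensor-product spline, and such an `s` is determined by its values
and first cross derivatives on the four sides of the square together with its values at the interior
Greville points. The theorem thus reduces to univariate interpolation, along the edges and in each
parameter direction, and to compatibility at the corners.

Univariate part: a spline of degree `r + μ` and regularity `r` is determined by Hermite data of `m ≤
r + 1` derivatives (orders `0, …, m - 1`) at both ends and by its values at all Greville abscissae
but the first and last `m`. For uniqueness, a nonzero spline is considered on a maximal block of
segments with nonzero pieces. Repeated use of Rolle's theorem bounds its zeros there
(`zeros_pwEval_le`), and the block contains too many Greville abscissae (`pieces_eq_zero`).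
Existence follows by counting dimensions (`exists_pieces`). The result is used with (degree, `μ`,
`m`) equal to `(p, 1, 3)` for traces, `(p - 1, 1, 2)` for normal derivatives and `(p, 2, 2)` for
slices of `s`.

Geometry: the bilinear map has positive Jacobian determinant and is a diffeomorphism of the square
onto the closed quadrilateral. Hence `φ` is `C¹`, and `C²` at the vertices, since splines are
polynomials near the end points. The two-jets at the vertices give the end data of traces and normal
derivatives. Cramer's rule turns a trace and a normal derivative into the derivative across the edge
(`crossFun`); its coefficients are affine along the edge, so it is a spline of degree `p` and
regularity `p - 2`.

Uniqueness: zero data annihilate traces, normal and cross derivatives, and then `s`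
(`tensor_eq_zero`). Existence: the interpolated edge data agree at every corner because they come
from one two-jet with symmetric quadratic part (`EdgeData.corner`); so `exists_tensor` yields `s`,
and `jet_ext` shows that the prescribed jets are attained. -/

namespace SplineElement

open Set

/-! ### Counting sign changes -/

/-- `g` takes values of alternating strict signs at `N` increasing points of `[a, b)`. -/
def Alternates (g : ℝ → ℝ) (a b : ℝ) (N : ℕ) : Prop :=
  ∃ (ε : ℝ) (x : ℕ → ℝ), (∀ i < N, a ≤ x i ∧ x i < b) ∧ (∀ i, i + 1 < N → x i < x (i + 1)) ∧
    ∀ i < N, 0 < ε * (-1) ^ i * g (x i)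

/-- A mean value theorem for signs. Right derivatives suffice, as is needed for derivatives of
splines that jump at the knots; `ε` treats increase and decrease at once. -/
theorem exists_pos_right_deriv {g g' : ℝ → ℝ} {u v ε : ℝ} (huv : u ≤ v)
    (hg : ContinuousOn g (Icc u v)) (hg' : ∀ x ∈ Ico u v, HasDerivWithinAt g (g' x) (Ici x) x)
    (h : ε * g u < ε * g v) : ∃ y ∈ Ico u v, 0 < ε * g' y := by
  by_contra! hcon
  have := image_le_of_deriv_right_le_deriv_boundary (f := fun x => ε * g x)
    (f' := fun x => ε * g' x) (a := u) (b := v) (continuousOn_const.mul hg)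
    (fun x hx => (hg' x hx).const_mul ε) (B := fun _ => ε * g u) (B' := fun _ => 0) le_rfl
    continuousOn_const (fun x _ => hasDerivWithinAt_const _ _ _) hcon (right_mem_Icc.2 huv)
  exact absurd this (not_le.2 h)

/-- Rolle's theorem for sign changes; a zero at an end point gives an additional sign change. -/
theorem Alternates.deriv {g g' : ℝ → ℝ} {a b : ℝ} {N da db M : ℕ} (h : Alternates g a b N)
    (hN : 1 ≤ N) (hg : ContinuousOn g (Icc a b))
    (hg' : ∀ x ∈ Ico a b, HasDerivWithinAt g (g' x) (Ici x) x)
    (hda : da ≤ 1) (hdb : db ≤ 1) (ha : da = 1 → g a = 0) (hb : db = 1 → g b = 0)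
    (hM : M + 1 = N + da + db) : Alternates g' a b M := by
  obtain ⟨ε, x, hx, hmono, hs⟩ := h
  have hpos : ∀ i < N, g (x i) ≠ 0 := fun i hi h0 => by simpa [h0] using hs i hi
  -- The alternation points, padded by `a` if `da = 1` and by `b` if `db = 1`. Since `g` vanishes at
  -- a padded end, the increments of `g` along `X` still alternate in sign.
  obtain ⟨X, hX⟩ : ∃ X : ℕ → ℝ, ∀ i, X i = if i < da then a else if i < da + N then x (i - da)
    else b := ⟨_, fun _ => rfl⟩
  have hXmem : ∀ i, X i ∈ Icc a b := by
    intro i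
    have h0 := hx 0 (by omega)
    rw [hX]
    split_ifs with h1 h2
    · exact ⟨le_rfl, by linarith⟩
    · exact ⟨(hx _ (by omega)).1, (hx _ (by omega)).2.le⟩
    · exact ⟨by linarith, le_rfl⟩
  have hXlt : ∀ i < M, X i < X (i + 1) ∧
      ε * (-1) ^ (da + i + 1) * g (X i) < ε * (-1) ^ (da + i + 1) * g (X (i + 1)) := by
    intro i hi
    refine ⟨?_, ?_⟩
    · rw [hX, hX]
      by_cases h1 : i < da
      · have hi0 : i = 0 := by omega
        have hda1 : da = 1 := by omega
        subst hi0; subst hda1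
        have : a ≠ x 0 := fun h => hpos 0 (by omega) (h ▸ ha rfl)
        have h0 := (hx 0 (by omega)).1
        simpa [show 0 < N by omega] using lt_of_le_of_ne h0 this
      · have h2 : i < da + N := by omega
        by_cases h3 : i + 1 < da + N
        · have := hmono (i - da) (by omega)
          simpa [h1, h2, h3, show ¬ i + 1 < da by omega, show i + 1 - da = i - da + 1 by omega]
            using this
        · simpa [h1, h2, h3, show ¬ i + 1 < da by omega] using (hx (i - da) (by omega)).2
    · rw [hX, hX]
      by_cases h1 : i < da
      · have hi0 : i = 0 := by omega
        have hda1 : da = 1 := by omega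
        subst hi0; subst hda1
        have := hs 0 (by omega)
        simpa [show 0 < N by omega, ha rfl] using this
      · have h2 : i < da + N := by omega
        obtain ⟨j, rfl⟩ : ∃ j, i = da + j := ⟨i - da, by omega⟩
        have e : (-1 : ℝ) ^ (da + (da + j) + 1) = - (-1) ^ j := by
          rw [show da + (da + j) + 1 = 2 * da + (j + 1) by ring, pow_add, pow_mul]; simp [pow_succ]
        have k1 := hs j (by omega)
        by_cases h3 : da + j + 1 < da + N
        · have k2 := hs (j + 1) (by omega)
          rw [pow_succ] at k2
          simp only [h1, h2, h3, show ¬ da + j + 1 < da by omega, if_true, if_false, e,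
            show da + j + 1 - da = j + 1 by omega, show da + j - da = j by omega]
          nlinarith
        · simp only [h1, h2, h3, show ¬ da + j + 1 < da by omega, if_true, if_false, e,
            hb (by omega), show da + j - da = j by omega]
          nlinarith
  have hex : ∀ i, ∃ y, i < M → (y ∈ Ico (X i) (X (i + 1)) ∧
      0 < ε * (-1) ^ (da + i + 1) * g' y) := by
    intro i
    by_cases hi : i < M
    · obtain ⟨y, hy, hy'⟩ := exists_pos_right_deriv (hXlt i hi).1.le
        (hg.mono (Icc_subset_Icc (hXmem i).1 (hXmem (i + 1)).2))
        (fun z hz => hg' z ⟨(hXmem i).1.trans hz.1, hz.2.trans_le (hXmem (i + 1)).2⟩)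
        (hXlt i hi).2
      exact ⟨y, fun _ => ⟨hy, hy'⟩⟩
    · exact ⟨0, fun h => absurd h hi⟩
  choose y hy using hex
  -- The points lie in half-open intervals `[X i, X (i + 1))`, so they increase strictly.
  refine ⟨ε * (-1) ^ (da + 1), y, fun i hi => ⟨(hXmem i).1.trans (hy i hi).1.1,
    (hy i hi).1.2.trans_le (hXmem (i + 1)).2⟩, fun i hi =>
      (hy i (by omega)).1.2.trans_le (hy (i + 1) hi).1.1, fun i hi => ?_⟩
  have := (hy i hi).2
  rwa [show da + i + 1 = (da + 1) + i by ring, pow_add, ← mul_assoc] at this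

/-- A function with `n` interior zeros and zeros at both ends that does not vanish on any
subinterval has a derivative with at least `n + 1` sign changes. -/
theorem alternates_deriv_of_zeros {g g' : ℝ → ℝ} {a b : ℝ} {n : ℕ} (hab : a < b)
    (hg : ContinuousOn g (Icc a b))
    (hg' : ∀ x ∈ Ico a b, HasDerivWithinAt g (g' x) (Ici x) x)
    (hne : ∀ u v, a ≤ u → u < v → v ≤ b → ∃ y ∈ Ioo u v, g y ≠ 0)
    (ha : g a = 0) (hb : g b = 0) (z : ℕ → ℝ) (hz : ∀ i < n, z i ∈ Ioo a b)
    (hzm : ∀ i, i + 1 < n → z i < z (i + 1)) (hz0 : ∀ i < n, g (z i) = 0) :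
    Alternates g' a b (n + 2) := by
  obtain ⟨X, hX⟩ : ∃ X : ℕ → ℝ, ∀ i, X i = if i = 0 then a else if i ≤ n then z (i - 1)
    else b := ⟨_, fun _ => rfl⟩
  have hXmem : ∀ i, X i ∈ Icc a b := by
    intro i
    rw [hX]
    split_ifs with h1 h2
    · exact ⟨le_rfl, hab.le⟩
    · exact ⟨(hz _ (by omega)).1.le, (hz _ (by omega)).2.le⟩
    · exact ⟨hab.le, le_rfl⟩
  have hX0 : ∀ i, g (X i) = 0 := by
    intro i
    rw [hX]
    split_ifs with h1 h2
    · exact ha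
    · exact hz0 _ (by omega)
    · exact hb
  have hXlt : ∀ i ≤ n, X i < X (i + 1) := by
    intro i hi
    rw [hX, hX]
    by_cases h1 : i = 0
    · by_cases h2 : 1 ≤ n
      · simpa [h1, h2] using (hz 0 (by omega)).1
      · simpa [h1, h2] using hab
    · by_cases h2 : i + 1 ≤ n
      · simpa [h1, hi, h2, show i - 1 + 1 = i by omega] using hzm (i - 1) (by omega)
      · simpa [h1, hi, h2] using (hz (i - 1) (by omega)).2
  have hcont : ∀ i, ∀ u v, X i ≤ u → v ≤ X (i + 1) → ContinuousOn g (Icc u v) := fun i u v h1 h2 =>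
    hg.mono (Icc_subset_Icc ((hXmem i).1.trans h1) (h2.trans (hXmem (i + 1)).2))
  have hder : ∀ i, ∀ u v, X i ≤ u → v ≤ X (i + 1) →
      ∀ x ∈ Ico u v, HasDerivWithinAt g (g' x) (Ici x) x := fun i u v h1 h2 x hx =>
    hg' x ⟨((hXmem i).1.trans h1).trans hx.1, hx.2.trans_le (h2.trans (hXmem (i + 1)).2)⟩
  -- Between two consecutive zeros `g` leaves zero and returns, so `g'` takes both strict signs
  -- there.
  have hpair : ∀ i ≤ n, ∃ σ : ℝ, ∃ y₁ y₂, X i ≤ y₁ ∧ y₁ < y₂ ∧ y₂ < X (i + 1) ∧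
      0 < σ * g' y₁ ∧ 0 < - σ * g' y₂ ∧ (σ = 1 ∨ σ = -1) := by
    intro i hi
    obtain ⟨y, hy, hy0⟩ := hne _ _ (hXmem i).1 (hXlt i hi) (hXmem (i + 1)).2
    obtain ⟨σ, hσ, hσy⟩ : ∃ σ : ℝ, (σ = 1 ∨ σ = -1) ∧ 0 < σ * g y := by
      rcases lt_or_gt_of_ne hy0 with h | h
      · exact ⟨-1, Or.inr rfl, by linarith⟩
      · exact ⟨1, Or.inl rfl, by linarith⟩
    obtain ⟨y₁, h₁, h₁'⟩ := exists_pos_right_deriv (ε := σ) hy.1.le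
      (hcont i _ _ le_rfl hy.2.le) (hder i _ _ le_rfl hy.2.le) (by rw [hX0]; linarith)
    obtain ⟨y₂, h₂, h₂'⟩ := exists_pos_right_deriv (ε := -σ) hy.2.le
      (hcont i _ _ hy.1.le le_rfl) (hder i _ _ hy.1.le le_rfl) (by rw [hX0]; linarith)
    exact ⟨σ, y₁, y₂, h₁.1, h₁.2.trans_le h₂.1, h₂.2, h₁', h₂', hσ⟩
  obtain ⟨σ, u₀, u₁, h0, h1, h2, h3, h4, hσ⟩ := hpair 0 (Nat.zero_le _)
  -- The first gap contributes both of its points, each of the `n` later gaps the one with the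
  -- required sign: `n + 2` points in all.
  have hany : ∀ i, ∃ y, i ≤ n → (X i ≤ y ∧ y < X (i + 1) ∧ 0 < σ * (-1) ^ (i + 1) * g' y ∧
      (i = 0 → u₀ < y)) := by
    intro i
    by_cases hi : i ≤ n
    · rcases Nat.eq_zero_or_pos i with rfl | hpos
      · exact ⟨u₁, fun _ => ⟨h0.trans h1.le, h2, by simpa using h4, fun _ => h1⟩⟩
      · obtain ⟨τ, y₁, y₂, k0, k1, k2, k3, k4, hτ⟩ := hpair i hi
        have : σ * (-1) ^ (i + 1) = τ ∨ σ * (-1) ^ (i + 1) = -τ := by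
          rcases neg_one_pow_eq_or ℝ (i + 1) with h | h <;> rw [h] <;>
            rcases hσ with rfl | rfl <;> rcases hτ with rfl | rfl <;> norm_num
        rcases this with h | h
        · exact ⟨y₁, fun _ => ⟨k0, k1.trans k2, by rwa [h], by omega⟩⟩
        · exact ⟨y₂, fun _ => ⟨k0.trans k1.le, k2, by rwa [h], by omega⟩⟩
    · exact ⟨0, fun h => absurd h hi⟩
  choose y hy using hany
  refine ⟨σ, fun i => if i = 0 then u₀ else y (i - 1), ?_, ?_, ?_⟩
  · intro i hi
    by_cases hi0 : i = 0
    · simpa [hi0] using And.intro ((hXmem 0).1.trans h0) ((h1.trans h2).trans_le (hXmem _).2)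
    · have := hy (i - 1) (by omega)
      simpa [hi0] using And.intro ((hXmem _).1.trans this.1) (this.2.1.trans_le (hXmem _).2)
  · intro i hi
    by_cases hi0 : i = 0
    · simpa [hi0] using (hy 0 (by omega)).2.2.2 rfl
    · have e1 := (hy (i - 1) (by omega)).2.1
      have e2 := (hy i (by omega)).1
      rw [show i - 1 + 1 = i by omega] at e1
      simpa [hi0] using e1.trans_le e2
  · intro i hi
    by_cases hi0 : i = 0
    · simpa [hi0] using h3
    · have := (hy (i - 1) (by omega)).2.2.1
      rw [show i - 1 + 1 = i by omega] at this
      simpa [hi0] using this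

/-- A polynomial of degree less than `μ` has at most `μ - 1` sign changes. -/
theorem not_alternates_of_natDegree_lt {P : Polynomial ℝ} {μ : ℕ} (hP : P.natDegree < μ)
    {ε : ℝ} {x : ℕ → ℝ} (hx : ∀ i < μ, x i < x (i + 1))
    (hs : ∀ i ≤ μ, 0 < ε * (-1) ^ i * P.eval (x i)) : False := by
  have hroot : ∀ i : Fin μ, ∃ y ∈ Ioo (x i) (x (i + 1)), P.eval y = 0 := by
    intro i
    have h1 := hs i i.2.le
    have h2 := hs (i + 1) i.2
    rw [pow_succ] at h2
    have hc : ContinuousOn (fun t => ε * (-1) ^ (i : ℕ) * P.eval t) (Icc (x i) (x (i + 1))) :=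
      continuousOn_const.mul P.continuous.continuousOn
    have := intermediate_value_Ioo' (hx i i.2).le hc
    obtain ⟨y, hy, hy0⟩ := this (⟨by linarith, by linarith⟩ : (0 : ℝ) ∈ Ioo _ _)
    have hne : ε * (-1) ^ (i : ℕ) ≠ 0 := fun h => by simp [h] at h1
    exact ⟨y, hy, (mul_eq_zero.1 hy0).resolve_left hne⟩
  choose y hy hy0 using hroot
  have hmono : ∀ i j : ℕ, i ≤ j → j ≤ μ → x i ≤ x j := by
    intro i j hij
    induction j, hij using Nat.le_induction with
    | base => intro _; exact le_rfl
    | succ j _ ih => intro hj; exact (ih (by omega)).trans (hx j (by omega)).le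
  have hinj : Function.Injective y := by
    have : StrictMono y := fun i j hij =>
      (hy i).2.trans_le ((hmono (i + 1) j hij j.2.le).trans (hy j).1.le)
    exact this.injective
  have := Polynomial.eq_zero_of_natDegree_lt_card_of_eval_eq_zero P hinj hy0 (by simpa using hP)
  simpa [this] using hs 0 (Nat.zero_le _)

end SplineElement

namespace SplineElement

open Set Polynomial

/-! ### Piecewise polynomials on the uniform partition -/

/-- The index of the segment that contains `x`. -/
noncomputable def segment (k : ℕ) (x : ℝ) : ℕ := min ⌊k * x⌋₊ (k - 1)

/-- The function that coincides with `P j` on the `j`-th segment. -/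
noncomputable def pwEval (k : ℕ) (P : ℕ → ℝ[X]) (x : ℝ) : ℝ := (P (segment k x)).eval x

/-- Adjacent pieces agree to the order `r` at their common knot. -/
def Matching (k r : ℕ) (P : ℕ → ℝ[X]) : Prop :=
  ∀ j, j + 1 < k → ∀ l ≤ r, (derivative^[l] (P j)).eval (((j + 1 : ℕ) : ℝ) / k) =
    (derivative^[l] (P (j + 1))).eval (((j + 1 : ℕ) : ℝ) / k)

theorem segment_lt {k : ℕ} (hk : 0 < k) (x : ℝ) : segment k x < k :=
  (min_le_right _ _).trans_lt (by omega)

theorem segment_eq {k j : ℕ} (hj : j < k) {x : ℝ} (h0 : (j : ℝ) / k ≤ x)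
    (h1 : x < ((j + 1 : ℕ) : ℝ) / k) : segment k x = j := by
  have hk : (0 : ℝ) < k := by exact_mod_cast (by omega : 0 < k)
  rw [div_le_iff₀ hk] at h0
  rw [lt_div_iff₀ hk] at h1
  have : ⌊k * x⌋₊ = j := by
    rw [Nat.floor_eq_iff (by nlinarith [Nat.cast_nonneg (α := ℝ) j])]
    push_cast at h1 ⊢
    constructor <;> linarith
  rw [segment, this]
  omega

/-- The cap in `segment` assigns `1` to the last piece; every other knot belongs to the piece on its
right, which makes right derivatives of `pwEval` available everywhere on `[0, 1)`. -/
theorem segment_one {k : ℕ} : segment k 1 = k - 1 := by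
  simp [segment]

theorem segment_bounds {k : ℕ} (hk : 0 < k) {x : ℝ} (h0 : 0 ≤ x) (h1 : x < 1) :
    ((segment k x : ℕ) : ℝ) / k ≤ x ∧ x < ((segment k x + 1 : ℕ) : ℝ) / k := by
  have hk' : (0 : ℝ) < k := by exact_mod_cast hk
  have hf : ⌊k * x⌋₊ < k := by
    rw [Nat.floor_lt (by positivity)]; nlinarith
  have : segment k x = ⌊k * x⌋₊ := min_eq_left (by omega)
  rw [this, div_le_iff₀ hk', lt_div_iff₀ hk']
  have e1 := Nat.floor_le (show 0 ≤ k * x by positivity)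
  have e2 := Nat.lt_floor_add_one (k * x)
  push_cast
  constructor <;> linarith

theorem node_mono {k i j : ℕ} (h : i ≤ j) : (i : ℝ) / k ≤ (j : ℝ) / k := by
  gcongr

theorem node_lt {k i j : ℕ} (hk : 0 < k) (h : i < j) : (i : ℝ) / k < (j : ℝ) / k := by
  have : (0 : ℝ) < k := by exact_mod_cast hk
  gcongr

theorem node_le_one {k j : ℕ} (hj : j ≤ k) : (j : ℝ) / k ≤ 1 :=
  div_le_one_of_le₀ (by exact_mod_cast hj) (by positivity)

theorem node_self {k : ℕ} (hk : 0 < k) : (k : ℝ) / k = 1 :=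
  div_self (by exact_mod_cast hk.ne')

/-- On the closed `j`-th segment the piecewise polynomial coincides with its `j`-th piece, if the
pieces match at the knots. -/
theorem pwEval_eq {k : ℕ} {P : ℕ → ℝ[X]} (hP : Matching k 0 P) {j : ℕ} (hj : j < k)
    {x : ℝ} (hx : x ∈ Icc ((j : ℝ) / k) (((j + 1 : ℕ) : ℝ) / k)) :
    pwEval k P x = (P j).eval x := by
  rcases hx.2.lt_or_eq with h | h
  · rw [pwEval, segment_eq hj hx.1 h]
  · subst h
    by_cases hjk : j + 1 < k
    · rw [pwEval, segment_eq hjk le_rfl (node_lt (by omega) (by omega))]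
      exact (hP j hjk 0 le_rfl).symm
    · obtain rfl : k = j + 1 := by omega
      rw [node_self (by omega), pwEval, segment_one]
      simp

theorem Matching.mono {k r r' : ℕ} {P : ℕ → ℝ[X]} (h : Matching k r P) (hr : r' ≤ r) :
    Matching k r' P := fun j hj l hl => h j hj l (hl.trans hr)

theorem Matching.derivative {k r : ℕ} {P : ℕ → ℝ[X]} (h : Matching k (r + 1) P) :
    Matching k r (fun j => derivative (P j)) := fun j hj l hl => by
  simpa only [← Function.iterate_succ_apply] using h j hj (l + 1) (by omega)

theorem Matching.iterate {k r l : ℕ} {P : ℕ → ℝ[X]} (h : Matching k r P) (hl : l ≤ r) :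
    Matching k (r - l) (fun j => Polynomial.derivative^[l] (P j)) := fun j hj m hm => by
  simpa only [← Function.iterate_add_apply] using h j hj (m + l) (by omega)

/-- Every point of `[0, 1]` lies in the closed segment with its index. -/
theorem mem_segment {k : ℕ} (hk : 0 < k) {x : ℝ} (hx : x ∈ Icc (0 : ℝ) 1) :
    x ∈ Icc ((segment k x : ℝ) / k) (((segment k x + 1 : ℕ) : ℝ) / k) := by
  rcases hx.2.lt_or_eq with h | h
  · exact ⟨(segment_bounds hk hx.1 h).1, (segment_bounds hk hx.1 h).2.le⟩
  · subst h
    rw [segment_one, Nat.sub_add_cancel hk, node_self hk]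
    exact ⟨node_le_one (by omega), le_rfl⟩

/-- A property of a set that is inherited by unions of two closed sets holds for `[0, 1]` if it
holds for all segments. -/
theorem segment_induction {k : ℕ} (hk : 0 < k) {p : Set ℝ → Prop}
    (hseg : ∀ j < k, p (Icc ((j : ℝ) / k) (((j + 1 : ℕ) : ℝ) / k)))
    (hunion : ∀ s t, IsClosed s → IsClosed t → p s → p t → p (s ∪ t)) : p (Icc 0 1) := by
  have : ∀ j, 0 < j → j ≤ k → p (Icc 0 ((j : ℝ) / k)) := by
    intro j hj
    induction j, hj using Nat.le_induction with
    | base => intro h; simpa using hseg 0 h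
    | succ j hj ih =>
      intro h
      rw [← Icc_union_Icc_eq_Icc (b := (j : ℝ) / k) (by positivity) (node_mono (by omega))]
      exact hunion _ _ isClosed_Icc isClosed_Icc (ih (by omega)) (hseg j h)
  simpa [node_self hk] using this k hk le_rfl

theorem continuousOn_pwEval {k : ℕ} (hk : 0 < k) {P : ℕ → ℝ[X]} (hP : Matching k 0 P) :
    ContinuousOn (pwEval k P) (Icc 0 1) := by
  refine segment_induction hk (p := ContinuousOn _) (fun j hj => ?_) fun s t hs ht h1 h2 =>
    h1.union_of_isClosed h2 hs ht
  exact (P j).continuous.continuousOn.congr fun x hx => pwEval_eq hP hj hx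

theorem hasDerivWithinAt_pwEval {k : ℕ} (hk : 0 < k) {P : ℕ → ℝ[X]} (hP : Matching k 1 P)
    {x : ℝ} :
    HasDerivWithinAt (pwEval k P) (pwEval k (fun j => derivative (P j)) x) (Icc 0 1) x := by
  refine segment_induction hk (p := fun s => HasDerivWithinAt _ _ s x) (fun j hj => ?_)
    fun s t _ _ h1 h2 => h1.union h2
  by_cases hx : x ∈ Icc ((j : ℝ) / k) (((j + 1 : ℕ) : ℝ) / k)
  · rw [pwEval_eq (hP.derivative (r := 0)) hj hx]
    exact ((P j).hasDerivAt x).hasDerivWithinAt.congr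
      (fun y hy => pwEval_eq (hP.mono (by omega)) hj hy) (pwEval_eq (hP.mono (by omega)) hj hx)
  -- Relative to a closed segment that does not contain `x`, every linear map is a derivative at
  -- `x`.
  · refine HasFDerivWithinAt.of_notMem_closure ?_
    rwa [isClosed_Icc.closure_eq]

/-- Right derivatives of piecewise polynomials exist without any smoothness at the knots. -/
theorem hasDerivWithinAt_pwEval_Ici {k : ℕ} (hk : 0 < k) (P : ℕ → ℝ[X]) {x : ℝ}
    (hx : x ∈ Ico (0 : ℝ) 1) :
    HasDerivWithinAt (pwEval k P) (pwEval k (fun j => derivative (P j)) x) (Ici x) x := by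
  have hb := segment_bounds hk hx.1 hx.2
  refine ((P (segment k x)).hasDerivAt x).hasDerivWithinAt.congr_of_eventuallyEq ?_ rfl
  filter_upwards [self_mem_nhdsWithin, mem_nhdsWithin_of_mem_nhds (Iio_mem_nhds hb.2)] with y h1 h2
  rw [pwEval, segment_eq (segment_lt hk x) (hb.1.trans h1) h2]

/-! ### Zeros of splines -/

/-- An interval inside the block shares an open interval with some segment, and a nonzero piece has
finitely many roots. This is the nonvanishing hypothesis of `alternates_deriv_of_zeros`. -/
theorem exists_pwEval_ne_zero {k : ℕ} (hk : 0 < k) {P : ℕ → ℝ[X]} {α β : ℕ} (hβ : β ≤ k)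
    (hne : ∀ j, α ≤ j → j < β → P j ≠ 0) {u v : ℝ} (hu : (α : ℝ) / k ≤ u) (huv : u < v)
    (hv : v ≤ (β : ℝ) / k) : ∃ y ∈ Ioo u v, pwEval k P y ≠ 0 := by
  have hu0 : 0 ≤ u := le_trans (by positivity) hu
  have hu1 : u < 1 := huv.trans_le (hv.trans (node_le_one hβ))
  have hb := segment_bounds hk hu0 hu1
  have hα : α ≤ segment k u := by
    by_contra! h
    exact absurd (hb.2.trans_le (node_mono h)) (not_lt.2 hu)
  have hβ' : segment k u < β := by
    by_contra! h
    exact absurd (huv.trans_le (hv.trans (node_mono h))) (not_lt.2 hb.1)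
  by_contra! hcon
  refine hne _ hα hβ' (Polynomial.eq_zero_of_infinite_isRoot _
    ((Ioo_infinite (lt_min huv hb.2)).mono fun y hy => ?_))
  have := hcon y ⟨hy.1, hy.2.trans_le (min_le_left _ _)⟩
  rwa [pwEval, segment_eq (segment_lt hk u) (hb.1.trans hy.1.le)
    (hy.2.trans_le (min_le_right _ _))] at this

/-- A piecewise polynomial of degree less than `μ` with `L` pieces has fewer than `μ L` sign
changes. -/
theorem alternates_pwEval_le {k : ℕ} (hk : 0 < k) {P : ℕ → ℝ[X]} {α β μ N : ℕ} (hβ : β ≤ k)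
    (hαβ : α ≤ β) (hμ : 1 ≤ μ)
    (hdeg : ∀ j < k, (P j).natDegree < μ)
    (h : Alternates (pwEval k P) ((α : ℝ) / k) ((β : ℝ) / k) N) : N ≤ μ * (β - α) := by
  obtain ⟨ε, x, hx, hmono, hs⟩ := h
  by_contra! hN
  have hb : ∀ i < N, ((segment k (x i) : ℕ) : ℝ) / k ≤ x i ∧
      x i < ((segment k (x i) + 1 : ℕ) : ℝ) / k := fun i hi =>
    segment_bounds hk (le_trans (by positivity) (hx i hi).1)
      ((hx i hi).2.trans_le (node_le_one hβ))
  have hm : ∀ i j, i ≤ j → j < N → x i ≤ x j := by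
    intro i j hij
    induction j, hij using Nat.le_induction with
    | base => intro _; exact le_rfl
    | succ j _ ih => intro hj; exact (ih (by omega)).trans (hmono j hj).le
  -- A polynomial of degree less than `μ` cannot alternate at `μ + 1` points, so `μ` steps always
  -- leave the segment.
  have hstep : ∀ i, i + μ < N → segment k (x i) < segment k (x (i + μ)) := by
    intro i hi
    by_contra! hle
    have hseg : ∀ l ≤ μ, segment k (x (i + l)) = segment k (x i) := by
      intro l hl
      refine segment_eq (segment_lt hk _) ((hb i (by omega)).1.trans
        (hm _ _ (by omega) (by omega))) ?_
      exact (hm _ (i + μ) (by omega) hi).trans_lt ((hb _ hi).2.trans_le (node_mono (by omega)))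
    refine not_alternates_of_natDegree_lt (hdeg _ (segment_lt hk (x i))) (ε := ε * (-1) ^ i)
      (x := fun l => x (i + l)) (fun l hl => hmono (i + l) (by omega)) fun l hl => ?_
    have := hs (i + l) (by omega)
    rwa [pow_add, ← mul_assoc, pwEval, hseg l hl] at this
  -- For `j = β - α` this puts an alternation point at or beyond `β / k`.
  have hge : ∀ j, μ * j < N → α + j ≤ segment k (x (μ * j)) := by
    intro j
    induction j with
    | zero =>
      intro h0
      by_contra! h
      exact absurd ((hb _ h0).2.trans_le (node_mono h)) (not_lt.2 (hx _ h0).1)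
    | succ j ih =>
      intro h
      rw [mul_add, mul_one] at h ⊢
      have := ih (by omega)
      have := hstep (μ * j) h
      omega
  have h1 := hge (β - α) hN
  have h2 := (hb _ hN).1.trans_lt (hx _ hN).2
  exact absurd h2 (not_lt.2 (node_mono (by omega)))

/-- The bound for the number of zeros of a spline of degree `r + μ` and regularity `r` on a block of
segments on which it does not vanish. -/
theorem zeros_pwEval_le {k : ℕ} (hk : 0 < k) {P : ℕ → ℝ[X]} {α β μ r n ma mb : ℕ} (hβ : β ≤ k)
    (hαβ : α < β) (hμ : 1 ≤ μ) (hr : 1 ≤ r) (hP : Matching k r P)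
    (hdeg : ∀ j < k, (P j).natDegree ≤ r + μ) (hne : ∀ j, α ≤ j → j < β → P j ≠ 0)
    (hma : 1 ≤ ma) (hma' : ma ≤ r + 1) (hmb : 1 ≤ mb) (hmb' : mb ≤ r + 1)
    (ha : ∀ l < ma, pwEval k (fun j => derivative^[l] (P j)) ((α : ℝ) / k) = 0)
    (hb : ∀ l < mb, pwEval k (fun j => derivative^[l] (P j)) ((β : ℝ) / k) = 0)
    (z : ℕ → ℝ) (hz : ∀ i < n, z i ∈ Ioo ((α : ℝ) / k) ((β : ℝ) / k))
    (hzm : ∀ i, i + 1 < n → z i < z (i + 1)) (hz0 : ∀ i < n, pwEval k P (z i) = 0) :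
    n + ma + mb ≤ r + μ * (β - α) := by
  by_contra! hcon
  have h01 : Icc ((α : ℝ) / k) ((β : ℝ) / k) ⊆ Icc 0 1 :=
    Icc_subset_Icc (by positivity) (node_le_one hβ)
  have h01' : Ico ((α : ℝ) / k) ((β : ℝ) / k) ⊆ Ico 0 1 :=
    Ico_subset_Ico (by positivity) (node_le_one hβ)
  have hcont : ∀ l ≤ r, ContinuousOn (pwEval k (fun j => derivative^[l] (P j)))
      (Icc ((α : ℝ) / k) ((β : ℝ) / k)) := fun l hl =>
    (continuousOn_pwEval hk ((hP.iterate hl).mono (Nat.zero_le _))).mono h01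
  have hder : ∀ l, ∀ x ∈ Ico ((α : ℝ) / k) ((β : ℝ) / k),
      HasDerivWithinAt (pwEval k (fun j => derivative^[l] (P j)))
        (pwEval k (fun j => derivative^[l + 1] (P j)) x) (Ici x) x := fun l x hx => by
    simpa only [Function.iterate_succ_apply'] using
      hasDerivWithinAt_pwEval_Ici hk (fun j => derivative^[l] (P j)) (h01' hx)
  -- Each differentiation costs one alternation point and gains one for each end where the
  -- differentiated function vanishes; the minima record the gains so far. The first differentiation
  -- starts from zeros instead of sign changes.
  have key : ∀ l, 1 ≤ l → l ≤ r + 1 → ∀ N, N + l = n + 1 + min l ma + min l mb →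
      Alternates (pwEval k (fun j => derivative^[l] (P j))) ((α : ℝ) / k) ((β : ℝ) / k) N := by
    intro l hl
    induction l, hl using Nat.le_induction with
    | base =>
      intro _ N hN
      obtain rfl : N = n + 2 := by omega
      exact alternates_deriv_of_zeros (node_lt hk hαβ) (hcont 0 (Nat.zero_le _)) (hder 0)
        (fun u v h1 h2 h3 => exists_pwEval_ne_zero hk hβ hne h1 h2 h3) (ha 0 hma) (hb 0 hmb)
        z hz hzm hz0
    | succ l hl ih =>
      intro hlr M hM
      obtain ⟨N, hN⟩ : ∃ N, N + l = n + 1 + min l ma + min l mb :=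
        ⟨n + 1 + min l ma + min l mb - l, by omega⟩
      exact (ih (by omega) N hN).deriv (da := min (l + 1) ma - min l ma)
        (db := min (l + 1) mb - min l mb) (by omega) (hcont l (by omega)) (hder l) (by omega)
        (by omega) (fun h => ha l (by omega)) (fun h => hb l (by omega)) (by omega)
  -- The derivative of order `r + 1` has pieces of degree less than `μ`, with no continuity
  -- required.
  have hfin := key (r + 1) (by omega) le_rfl (n + ma + mb - r) (by omega)
  have := alternates_pwEval_le hk hβ hαβ.le hμ (fun j hj => ?_) hfin
  · omega
  · have h1 := Polynomial.natDegree_iterate_derivative (P j) (r + 1)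
    have h2 := hdeg j hj
    omega

end SplineElement

namespace SplineElement

open Set Polynomial

/-! ### Greville abscissae -/

/-- For `1 ≤ j < k`, the knot `j / k` occupies the indices from `d + 1 + μ (j - 1)` to `d + μ j`.
The case `α = 0` is separate because `0` has multiplicity `d + 1`. -/
theorem le_knot {d μ k α i : ℕ} (hμ : 1 ≤ μ) (hα : α ≤ k)
    (h : α = 0 ∨ d + 1 + μ * (α - 1) ≤ i) : (α : ℝ) / k ≤ knot d μ k i := by
  rw [knot]
  rcases h with rfl | h
  · simp only [Nat.cast_zero, zero_div]
    split_ifs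
    · exact le_rfl
    · exact le_min zero_le_one (by positivity)
  · rw [if_neg (by omega)]
    refine le_min (node_le_one hα) (node_mono ?_)
    have : α - 1 ≤ (i - d - 1) / μ := (Nat.le_div_iff_mul_le hμ).2 (by rw [mul_comm]; omega)
    omega

theorem knot_le {d μ k β i : ℕ} (hμ : 1 ≤ μ) (h : i ≤ d + μ * β) :
    knot d μ k i ≤ (β : ℝ) / k := by
  rw [knot]
  split_ifs with hi
  · positivity
  · refine (min_le_right _ _).trans (node_mono ?_)
    have : (i - d - 1) / μ < β := (Nat.div_lt_iff_lt_mul hμ).2 (by rw [mul_comm]; omega)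
    omega

theorem knot_nonneg {d μ k i : ℕ} : 0 ≤ knot d μ k i := by
  rw [knot]
  split_ifs
  · exact le_rfl
  · exact le_min zero_le_one (by positivity)

theorem knot_le_one {d μ k i : ℕ} : knot d μ k i ≤ 1 := by
  rw [knot]
  split_ifs
  · exact zero_le_one
  · exact min_le_left _ _

/-- All averaged knots are at least `α / k`, and the last one is at least `(α + 1) / k`. In
`greville_lt` the first knot provides the strictness. -/
theorem lt_greville {d μ k α i : ℕ} (hμ : 1 ≤ μ) (hd : 1 ≤ d) (hα : α < k)
    (h1 : α = 0 ∨ d + μ * (α - 1) ≤ i) (h2 : 1 + μ * α ≤ i) :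
    (α : ℝ) / k < greville d μ k i := by
  have hd' : (0 : ℝ) < d := by exact_mod_cast hd
  rw [greville, lt_div_iff₀ hd']
  calc (α : ℝ) / k * d = ∑ j ∈ Finset.Icc 1 d, (α : ℝ) / k := by simp [mul_comm]
    _ < _ := Finset.sum_lt_sum
      (fun j hj => le_knot hμ hα.le (h1.imp_right fun h => by
        have := Finset.mem_Icc.1 hj
        omega))
      ⟨d, Finset.mem_Icc.2 ⟨hd, le_rfl⟩, (node_lt (by omega) (Nat.lt_succ_self α)).trans_le
        (le_knot hμ hα (Or.inr (by simp; omega)))⟩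

theorem greville_lt {d μ k β i : ℕ} (hμ : 1 ≤ μ) (hd : 1 ≤ d) (hβ : 1 ≤ β) (hβk : β ≤ k)
    (h1 : β = k ∨ i ≤ μ * β) (h2 : i + 1 ≤ d + μ * (β - 1)) :
    greville d μ k i < (β : ℝ) / k := by
  have hd' : (0 : ℝ) < d := by exact_mod_cast hd
  rw [greville, div_lt_iff₀ hd']
  calc
    _ < ∑ j ∈ Finset.Icc 1 d, (β : ℝ) / k := Finset.sum_lt_sum
      (fun j hj => by
        rcases h1 with rfl | h1
        · rw [node_self hβ]
          exact knot_le_one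
        · have := Finset.mem_Icc.1 hj
          exact knot_le hμ (by omega))
      ⟨1, Finset.mem_Icc.2 ⟨le_rfl, hd⟩, (knot_le hμ h2).trans_lt (node_lt (by omega) (by omega))⟩
    _ = (β : ℝ) / k * d := by simp [mul_comm]

theorem sum_Icc_shift (f : ℕ → ℝ) (d : ℕ) :
    ∑ j ∈ Finset.Icc 1 d, f (j + 1) + f 1 = ∑ j ∈ Finset.Icc 1 d, f j + f (d + 1) := by
  induction d with
  | zero => simp
  | succ d ih =>
    rw [Finset.sum_Icc_succ_top (by omega), Finset.sum_Icc_succ_top (by omega)]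
    linarith

/-- Passing to the next average replaces the knot with index `i + 1` by the one with index `i + d +
1`, so it suffices that these two differ. -/
theorem greville_lt_succ {d μ k i : ℕ} (hμ : 1 ≤ μ) (hk : 0 < k) (hd : μ ≤ d)
    (hi : i + 1 ≤ d + μ * (k - 1)) : greville d μ k i < greville d μ k (i + 1) := by
  have hd' : (0 : ℝ) < d := by exact_mod_cast (by omega : 0 < d)
  -- `β` separates the two knots: one is at most `β / k`, the other at least `(β + 1) / k`.
  obtain ⟨β, h1, h2, h3⟩ : ∃ β, i + 1 ≤ d + μ * β ∧ μ * β ≤ i ∧ β + 1 ≤ k := by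
    by_cases h : i < d
    · exact ⟨0, by omega, by omega, by omega⟩
    · refine ⟨(i - d) / μ + 1, ?_, ?_, ?_⟩
      · have := Nat.lt_mul_div_succ (i - d) hμ
        omega
      · have := Nat.mul_div_le (i - d) μ
        rw [mul_add]
        omega
      · have : (i - d) / μ < k - 1 := (Nat.div_lt_iff_lt_mul hμ).2 (by rw [mul_comm]; omega)
        omega
  have hlt : knot d μ k (i + 1) < knot d μ k (i + (d + 1)) :=
    (knot_le hμ h1).trans_lt ((node_lt hk (Nat.lt_succ_self β)).trans_le
      (le_knot hμ h3 (Or.inr (by simp; omega))))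
  have hs := sum_Icc_shift (fun j => knot d μ k (i + j)) d
  rw [greville, greville]
  refine div_lt_div_of_pos_right ?_ hd'
  simp only [show ∀ j, i + 1 + j = i + (j + 1) from fun j => by ring]
  linarith

theorem greville_mem {d μ k i : ℕ} : greville d μ k i ∈ Icc (0 : ℝ) 1 := by
  rw [greville]
  refine ⟨div_nonneg (Finset.sum_nonneg fun _ _ => knot_nonneg) (by positivity),
    div_le_one_of_le₀ ?_ (by positivity)⟩
  calc _ ≤ ∑ j ∈ Finset.Icc 1 d, (1 : ℝ) := Finset.sum_le_sum fun _ _ => knot_le_one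
    _ = d := by simp

/-! ### Unisolvence for univariate splines -/

/-- On a maximal block of nonzero pieces, a block end interior to `[0, 1]` adjoins a zero piece, so
matching gives a zero of order `r + 1` there. The zeros at the block ends and at the Greville
abscissae inside exceed the bound of `zeros_pwEval_le`. -/
theorem pieces_eq_zero {k r μ m : ℕ} (hk : 0 < k) (hμ : 1 ≤ μ) (hr : 1 ≤ r) (hm : 1 ≤ m)
    (hmr : m ≤ r + 1) {P : ℕ → ℝ[X]} (hP : Matching k r P)
    (hdeg : ∀ j < k, (P j).natDegree ≤ r + μ)
    (h0 : ∀ l < m, (derivative^[l] (P 0)).eval 0 = 0)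
    (h1 : ∀ l < m, (derivative^[l] (P (k - 1))).eval 1 = 0)
    (hz : ∀ i, m ≤ i → i + m < r + μ + 1 + μ * (k - 1) →
      pwEval k P (greville (r + μ) μ k i) = 0) :
    ∀ j < k, P j = 0 := by
  classical
  by_contra! hex
  obtain ⟨α, ⟨hαk, hα0⟩, hαmin⟩ : ∃ α, (α < k ∧ P α ≠ 0) ∧ ∀ j < α, ¬ (j < k ∧ P j ≠ 0) :=
    ⟨Nat.find hex, Nat.find_spec hex, fun j hj => Nat.find_min hex hj⟩
  have hex' : ∃ β, α < β ∧ (β = k ∨ P β = 0) := ⟨k, hαk, Or.inl rfl⟩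
  obtain ⟨β, ⟨hαβ, hβ0⟩, hβmin⟩ : ∃ β, (α < β ∧ (β = k ∨ P β = 0)) ∧
      ∀ j < β, ¬ (α < j ∧ (j = k ∨ P j = 0)) :=
    ⟨Nat.find hex', Nat.find_spec hex', fun j hj => Nat.find_min hex' hj⟩
  have hβk : β ≤ k := by
    by_contra! h
    exact hβmin k h ⟨hαk, Or.inl rfl⟩
  have hne : ∀ j, α ≤ j → j < β → P j ≠ 0 := by
    intro j hj hjβ hj0
    rcases hj.eq_or_lt with rfl | h
    · exact hα0 hj0
    · exact hβmin j hjβ ⟨h, Or.inr hj0⟩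
  have hβzero : β ≠ k → P β = 0 := fun h => hβ0.resolve_left h
  -- `ma`, `mb` are the orders of vanishing at the block ends. The indices `imin ≤ i < imax` give
  -- prescribed Greville abscissae strictly inside the block. If the block is all of `[0, 1]`, the
  -- total exceeds the bound by exactly one.
  set ma := if α = 0 then m else r + 1 with hma
  set mb := if β = k then m else r + 1 with hmb
  set imin := if α = 0 then m else r + μ + μ * (α - 1) with himin
  set imax := if β = k then r + μ + 1 + μ * (k - 1) - m else μ * β + 1 with himax
  have hprod : μ * (β - α) + μ * α = μ * β := by rw [← mul_add]; congr 1; omega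
  have hprod1 : α ≠ 0 → μ * (α - 1) + μ = μ * α := fun h => by
    obtain ⟨a, rfl⟩ := Nat.exists_eq_succ_of_ne_zero h
    simp [mul_add]
  have hprod2 : μ * (β - 1) + μ = μ * β := by
    obtain ⟨a, rfl⟩ := Nat.exists_eq_succ_of_ne_zero (show β ≠ 0 by omega)
    simp [mul_add]
  have hprod3 : μ * (k - 1) + μ = μ * k := by
    obtain ⟨a, rfl⟩ := Nat.exists_eq_succ_of_ne_zero (show k ≠ 0 by omega)
    simp [mul_add]
  have hprod4 : α = 0 → μ * α = 0 := fun h => by simp [h]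
  have hprod5 : β ≠ k → μ * β + μ ≤ μ * k := fun h => by
    calc μ * β + μ = μ * (β + 1) := by ring
      _ ≤ μ * k := Nat.mul_le_mul_left _ (by omega)
  have hprod6 : β = k → μ * β = μ * k := fun h => by rw [h]
  have hma1 : 1 ≤ ma ∧ ma ≤ r + 1 := by rw [hma]; split_ifs <;> omega
  have hmb1 : 1 ≤ mb ∧ mb ≤ r + 1 := by rw [hmb]; split_ifs <;> omega
  have hrange : ∀ i < imax - imin, m ≤ imin + i ∧ imin + i + m < r + μ + 1 + μ * (k - 1) ∧
      (α = 0 ∨ r + μ + μ * (α - 1) ≤ imin + i) ∧ 1 + μ * α ≤ imin + i ∧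
      (β = k ∨ imin + i ≤ μ * β) ∧ imin + i + 1 ≤ r + μ + μ * (β - 1) := by
    intro i hi
    simp only [himin, himax] at hi ⊢
    split_ifs at hi ⊢ <;> refine ⟨?_, ?_, ?_, ?_, ?_, ?_⟩ <;> omega
  have hbound := zeros_pwEval_le hk (α := α) (β := β) (ma := ma) (mb := mb) (n := imax - imin)
    hβk hαβ hμ hr hP hdeg hne hma1.1 hma1.2 hmb1.1 hmb1.2 ?_ ?_
    (fun i => greville (r + μ) μ k (imin + i)) ?_ ?_ ?_
  · simp only [hma, hmb, himin, himax] at hbound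
    split_ifs at hbound <;> omega
  · intro l hl
    rw [pwEval, segment_eq hαk le_rfl (node_lt hk (by omega))]
    by_cases h : α = 0
    · subst h
      simpa using h0 l (by simpa [hma] using hl)
    · obtain ⟨a, rfl⟩ := Nat.exists_eq_succ_of_ne_zero h
      have hPa : P a = 0 := by
        by_contra hPa
        exact hαmin a (by omega) ⟨by omega, hPa⟩
      have := hP a hαk l (by simp [hma] at hl; omega)
      rw [hPa] at this
      simpa using this.symm
  · intro l hl
    by_cases h : β = k
    · subst h
      rw [node_self hk, pwEval, segment_one]
      exact h1 l (by simpa [hmb] using hl)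
    · rw [pwEval, segment_eq (by omega) le_rfl (node_lt hk (by omega)), hβzero h]
      simp
  · intro i hi
    obtain ⟨-, -, h3, h4, h5, h6⟩ := hrange i hi
    exact ⟨lt_greville hμ (by omega) hαk h3 h4, greville_lt hμ (by omega) (by omega) hβk h5 h6⟩
  · intro i hi
    have h6 := (hrange i (by omega)).2.1
    exact greville_lt_succ hμ hk (by omega) (by omega)
  · intro i hi
    exact hz _ (hrange i hi).1 (hrange i hi).2.1

/-- The jumps at the knots are included among the data, so the map starts from unconstrained tuples
of polynomials and the dimension of the spline space is not needed: `k (r + μ + 1) = (k - 1) (r + 1)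
+ 2 m + n`. Injectivity is `pieces_eq_zero`. -/
theorem exists_pieces {k r μ m n : ℕ} (hk : 0 < k) (hμ : 1 ≤ μ) (hr : 1 ≤ r) (hm : 1 ≤ m)
    (hmr : m ≤ r + 1) (hn : n + 2 * m = r + μ + 1 + μ * (k - 1)) (a b : Fin m → ℝ)
    (c : Fin n → ℝ) :
    ∃ P : ℕ → ℝ[X], Matching k r P ∧ (∀ j < k, (P j).natDegree ≤ r + μ) ∧
      (∀ l : Fin m, (derivative^[l] (P 0)).eval 0 = a l) ∧
      (∀ l : Fin m, (derivative^[l] (P (k - 1))).eval 1 = b l) ∧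
      ∀ i : Fin n, pwEval k P (greville (r + μ) μ k (i + m)) = c i := by
  obtain ⟨T, hT⟩ : ∃ T : (Fin k → degreeLT ℝ (r + μ + 1)) → ℕ → ℝ[X],
      ∀ q j, T q j = if h : j < k then (q ⟨j, h⟩ : ℝ[X]) else 0 := ⟨_, fun _ _ => rfl⟩
  have hTadd : ∀ q q' j, T (q + q') j = T q j + T q' j := by
    intro q q' j; rw [hT, hT, hT]; split_ifs <;> simp
  have hTsmul : ∀ (t : ℝ) q j, T (t • q) j = t • T q j := by
    intro t q j; rw [hT, hT]; split_ifs <;> simp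
  have hTdeg : ∀ q, ∀ j < k, (T q j).natDegree ≤ r + μ := by
    intro q j hj
    rw [hT, dif_pos hj]
    have := mem_degreeLT.1 (q ⟨j, hj⟩).2
    exact natDegree_le_of_degree_le (Order.le_of_lt_succ (by exact_mod_cast this))
  let Λ : (Fin k → degreeLT ℝ (r + μ + 1)) →ₗ[ℝ]
      ((Fin (k - 1) → Fin (r + 1) → ℝ) × (Fin m → ℝ) × (Fin m → ℝ) × (Fin n → ℝ)) :=
    { toFun := fun q => (fun j l => (derivative^[l] (T q j)).eval (((j + 1 : ℕ) : ℝ) / k) -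
          (derivative^[l] (T q (j + 1))).eval (((j + 1 : ℕ) : ℝ) / k),
        fun l => (derivative^[l] (T q 0)).eval 0,
        fun l => (derivative^[l] (T q (k - 1))).eval 1,
        fun i => pwEval k (T q) (greville (r + μ) μ k (i + m)))
      map_add' := by
        intro q q'
        refine Prod.ext ?_ (Prod.ext ?_ (Prod.ext ?_ ?_))
        · funext j l; simp [hTadd, iterate_map_add]; ring
        · funext l; simp [hTadd, iterate_map_add]
        · funext l; simp [hTadd, iterate_map_add]
        · funext l; simp [hTadd, pwEval]
      map_smul' := by
        intro t q
        refine Prod.ext ?_ (Prod.ext ?_ (Prod.ext ?_ ?_))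
        · funext j l; simp [hTsmul, iterate_derivative_smul]; ring
        · funext l; simp [hTsmul, iterate_derivative_smul]
        · funext l; simp [hTsmul, iterate_derivative_smul]
        · funext l; simp [hTsmul, pwEval] }
  have hmatch : ∀ q, (Λ q).1 = 0 → Matching k r (T q) := by
    intro q hq j hj l hl
    have := congrFun (congrFun hq ⟨j, by omega⟩) ⟨l, by omega⟩
    exact sub_eq_zero.1 this
  have hinj : Function.Injective Λ := by
    rw [← LinearMap.ker_eq_bot, LinearMap.ker_eq_bot']
    intro q hq
    have hz := pieces_eq_zero (P := T q) hk hμ hr hm hmr (hmatch q (by rw [hq]; rfl)) (hTdeg q)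
      (fun l hl => congrFun (congrArg (fun w => w.2.1) hq) ⟨l, hl⟩)
      (fun l hl => congrFun (congrArg (fun w => w.2.2.1) hq) ⟨l, hl⟩) ?_
    · funext j
      have := hz j j.2
      rw [hT, dif_pos j.2] at this
      exact Subtype.ext this
    · intro i h1 h2
      have := congrFun (congrArg (fun w => w.2.2.2) hq) ⟨i - m, by omega⟩
      simpa [Λ, Nat.sub_add_cancel h1] using this
  have hdim : Module.finrank ℝ (Fin k → degreeLT ℝ (r + μ + 1)) = Module.finrank ℝ
      ((Fin (k - 1) → Fin (r + 1) → ℝ) × (Fin m → ℝ) × (Fin m → ℝ) × (Fin n → ℝ)) := by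
    have h1 : Module.finrank ℝ (degreeLT ℝ (r + μ + 1)) = r + μ + 1 := by
      rw [(degreeLTEquiv ℝ (r + μ + 1)).finrank_eq, Module.finrank_fin_fun]
    obtain ⟨k', rfl⟩ := Nat.exists_eq_succ_of_ne_zero hk.ne'
    simp only [Module.finrank_prod, Module.finrank_pi_fintype, h1, Module.finrank_self,
      Finset.sum_const, Finset.card_univ, Fintype.card_fin, smul_eq_mul, Nat.succ_eq_add_one,
      Nat.add_sub_cancel] at hn ⊢
    nlinarith
  have : FiniteDimensional ℝ (degreeLT ℝ (r + μ + 1)) :=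
    (degreeLTEquiv ℝ (r + μ + 1)).symm.finiteDimensional
  obtain ⟨q, hq⟩ := (LinearMap.injective_iff_surjective_of_finrank_eq_finrank hdim).1 hinj
    (0, a, b, c)
  exact ⟨T q, hmatch q (by rw [hq]), hTdeg q,
    fun l => congrFun (congrArg (fun w => w.2.1) hq) l,
    fun l => congrFun (congrArg (fun w => w.2.2.1) hq) l,
    fun i => congrFun (congrArg (fun w => w.2.2.2) hq) i⟩

end SplineElement

namespace SplineElement

open Set Polynomial

/-! ### Splines as piecewise polynomials with matching pieces -/

theorem uniqueDiffOn_unitInterval : UniqueDiffOn ℝ (Icc (0 : ℝ) 1) := uniqueDiffOn_Icc zero_lt_one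

theorem segment_subset {k j : ℕ} (hj : j < k) :
    Icc ((j : ℝ) / k) (((j + 1 : ℕ) : ℝ) / k) ⊆ Icc 0 1 :=
  Icc_subset_Icc (by positivity) (node_le_one hj)

/-- The derivative relative to `[0, 1]` is also one relative to each segment, where derivatives are
unique. -/
theorem iteratedDerivWithin_eq_of_pieces {k r : ℕ} {f : ℝ → ℝ} {P : ℕ → ℝ[X]}
    (hf : ContDiffOn ℝ r f (Icc 0 1))
    (hP : ∀ j < k, ∀ x ∈ Icc ((j : ℝ) / k) (((j + 1 : ℕ) : ℝ) / k), f x = (P j).eval x)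
    {l : ℕ} (hl : l ≤ r) : ∀ j < k, ∀ x ∈ Icc ((j : ℝ) / k) (((j + 1 : ℕ) : ℝ) / k),
      iteratedDerivWithin l f (Icc 0 1) x = (derivative^[l] (P j)).eval x := by
  induction l with
  | zero => simpa using hP
  | succ l ih =>
    intro j hj x hx
    have hd := hf.differentiableOn_iteratedDerivWithin (m := l) (by exact_mod_cast hl)
      uniqueDiffOn_unitInterval
    have h1 := ((hd x (segment_subset hj hx)).hasDerivWithinAt).mono (segment_subset hj)
    have h2 := (((derivative^[l] (P j)).hasDerivAt x).hasDerivWithinAt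
      (s := Icc ((j : ℝ) / k) (((j + 1 : ℕ) : ℝ) / k))).congr (fun y hy => ih (by omega) j hj y hy)
      (ih (by omega) j hj x hx)
    rw [iteratedDerivWithin_succ, Function.iterate_succ_apply']
    exact (uniqueDiffOn_Icc (node_lt (by omega) (Nat.lt_succ_self j)) x hx).eq_deriv _ h1 h2

theorem exists_pieces_of_mem {d r k : ℕ} (hk : 0 < k) {f : ℝ → ℝ} (hf : f ∈ splineSpace d r k) :
    ∃ P : ℕ → ℝ[X], Matching k r P ∧ (∀ j < k, (P j).natDegree ≤ d) ∧
      (∀ j < k, ∀ x ∈ Icc ((j : ℝ) / k) (((j + 1 : ℕ) : ℝ) / k), f x = (P j).eval x) ∧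
      ∀ l ≤ r, ∀ x ∈ Icc (0 : ℝ) 1, iteratedDerivWithin l f (Icc 0 1) x =
        pwEval k (fun j => derivative^[l] (P j)) x := by
  obtain ⟨hf1, hf2⟩ := hf
  have hf3 : ∀ j, ∃ P : ℝ[X], j < k → (P.natDegree ≤ d ∧
      ∀ x ∈ Icc ((j : ℝ) / k) (((j + 1 : ℕ) : ℝ) / k), f x = P.eval x) := by
    intro j
    by_cases hj : j < k
    · obtain ⟨P, hP⟩ := hf2 j hj
      exact ⟨P, fun _ => by simpa using hP⟩
    · exact ⟨0, fun h => absurd h hj⟩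
  choose P hP using hf3
  have key := fun l (hl : l ≤ r) =>
    iteratedDerivWithin_eq_of_pieces hf1 (fun j hj => (hP j hj).2) hl
  refine ⟨P, fun j hj l hl => ?_, fun j hj => (hP j hj).1, fun j hj => (hP j hj).2,
    fun l hl x hx => key l hl _ (segment_lt hk x) x (mem_segment hk hx)⟩
  -- At a common knot both pieces compute the same derivative of `f`, which is the matching
  -- condition.
  rw [← key l hl j (by omega) _ ⟨node_mono (by omega), le_rfl⟩,
    ← key l hl (j + 1) hj _ ⟨le_rfl, node_mono (by omega)⟩]

theorem contDiffOn_pwEval {k r : ℕ} (hk : 0 < k) {P : ℕ → ℝ[X]} (hP : Matching k r P) :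
    ContDiffOn ℝ r (pwEval k P) (Icc 0 1) := by
  induction r generalizing P with
  | zero => simpa using continuousOn_pwEval hk hP
  | succ r ih =>
    have hder := fun x => hasDerivWithinAt_pwEval hk (hP.mono (r' := 1) (by omega)) (x := x)
    push_cast
    rw [contDiffOn_succ_iff_derivWithin uniqueDiffOn_unitInterval]
    refine ⟨fun x _ => (hder x).differentiableWithinAt, by simp, (ih hP.derivative).congr
      fun x hx => (hder x).derivWithin (uniqueDiffOn_unitInterval x hx)⟩

theorem pwEval_mem_splineSpace {d r k : ℕ} (hk : 0 < k) {P : ℕ → ℝ[X]} (hP : Matching k r P)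
    (hdeg : ∀ j < k, (P j).natDegree ≤ d) : pwEval k P ∈ splineSpace d r k :=
  ⟨contDiffOn_pwEval hk hP, fun j hj => ⟨P j, hdeg j hj, fun x hx =>
    pwEval_eq (hP.mono (Nat.zero_le _)) hj (by simpa using hx)⟩⟩

theorem segment_zero {k : ℕ} : segment k 0 = 0 := by simp [segment]

/-- A spline of degree `r + μ` and regularity `r` vanishes if it vanishes to the order `m` at the end
points and at all but the first and the last `m` Greville abscissae. -/
theorem spline_eq_zero {d r μ m k : ℕ} (hk : 0 < k) (hμ : 1 ≤ μ) (hr : 1 ≤ r) (hm : 1 ≤ m)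
    (hmr : m ≤ r + 1) (hd : d = r + μ) {f : ℝ → ℝ} (hf : f ∈ splineSpace d r k)
    (h0 : ∀ l < m, iteratedDerivWithin l f (Icc 0 1) 0 = 0)
    (h1 : ∀ l < m, iteratedDerivWithin l f (Icc 0 1) 1 = 0)
    (hz : ∀ i, m ≤ i → i + m < d + 1 + μ * (k - 1) → f (greville d μ k i) = 0) :
    ∀ x ∈ Icc (0 : ℝ) 1, f x = 0 := by
  subst hd
  obtain ⟨P, hP, hdeg, -, hder⟩ := exists_pieces_of_mem hk hf
  have hval : ∀ x ∈ Icc (0 : ℝ) 1, f x = pwEval k P x := fun x hx => by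
    simpa using hder 0 (Nat.zero_le _) x hx
  have hzero := pieces_eq_zero hk hμ hr hm hmr hP hdeg (fun l hl => ?_) (fun l hl => ?_)
    fun i hi hi' => by rw [← hval _ greville_mem]; exact hz i hi hi'
  · intro x hx
    rw [hval x hx, pwEval, hzero _ (segment_lt hk x), eval_zero]
  · have := hder l (by omega) 0 ⟨le_rfl, zero_le_one⟩
    rw [h0 l hl, pwEval, segment_zero] at this
    exact this.symm
  · have := hder l (by omega) 1 ⟨zero_le_one, le_rfl⟩
    rw [h1 l hl, pwEval, segment_one] at this
    exact this.symm

/-- Hermite data at the end points and values at the remaining Greville abscissae can be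
interpolated by splines. -/
theorem exists_spline {d r μ m n k : ℕ} (hk : 0 < k) (hμ : 1 ≤ μ) (hr : 1 ≤ r) (hm : 1 ≤ m)
    (hmr : m ≤ r + 1) (hd : d = r + μ) (hn : n + 2 * m = d + 1 + μ * (k - 1)) (a b : Fin m → ℝ)
    (c : Fin n → ℝ) : ∃ f ∈ splineSpace d r k,
      (∀ l : Fin m, iteratedDerivWithin l f (Icc 0 1) 0 = a l) ∧
      (∀ l : Fin m, iteratedDerivWithin l f (Icc 0 1) 1 = b l) ∧
      ∀ i : Fin n, f (greville d μ k (i + m)) = c i := by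
  subst hd
  obtain ⟨P, hP, hdeg, ha, hb, hc⟩ := exists_pieces hk hμ hr hm hmr hn a b c
  have hiter := fun l (hl : l ≤ r) => iteratedDerivWithin_eq_of_pieces (contDiffOn_pwEval hk hP)
    (fun j hj x hx => pwEval_eq (hP.mono (Nat.zero_le _)) hj hx) hl
  refine ⟨pwEval k P, pwEval_mem_splineSpace hk hP hdeg, fun l => ?_, fun l => ?_, hc⟩
  · rw [hiter l (by omega) _ (segment_lt hk 0) 0 (mem_segment hk ⟨le_rfl, zero_le_one⟩),
      segment_zero, ha]
  · rw [hiter l (by omega) _ (segment_lt hk 1) 1 (mem_segment hk ⟨zero_le_one, le_rfl⟩),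
      segment_one, hb]

/-! ### Operations on splines -/

theorem splineSpace_mono {d d' r r' k : ℕ} (hd : d ≤ d') (hr : r' ≤ r) {f : ℝ → ℝ}
    (hf : f ∈ splineSpace d r k) : f ∈ splineSpace d' r' k :=
  ⟨hf.1.of_le (by exact_mod_cast hr), fun j hj => by
    obtain ⟨P, hP, h⟩ := hf.2 j hj
    exact ⟨P, hP.trans hd, h⟩⟩

theorem splineSpace_congr {d r k : ℕ} {f g : ℝ → ℝ} (hf : f ∈ splineSpace d r k)
    (hfg : ∀ x ∈ Icc (0 : ℝ) 1, g x = f x) : g ∈ splineSpace d r k :=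
  ⟨hf.1.congr hfg, fun j hj => by
    obtain ⟨P, hP, h⟩ := hf.2 j hj
    refine ⟨P, hP, fun x hx => ?_⟩
    rw [← h x hx]
    exact hfg x (segment_subset hj (by simpa using hx))⟩

theorem derivWithin_mem_splineSpace {d r k : ℕ} (hk : 0 < k) {f : ℝ → ℝ}
    (hf : f ∈ splineSpace d (r + 1) k) :
    (fun x => derivWithin f (Icc 0 1) x) ∈ splineSpace (d - 1) r k := by
  obtain ⟨P, hP, hdeg, -, hder⟩ := exists_pieces_of_mem hk hf
  refine splineSpace_congr (pwEval_mem_splineSpace hk hP.derivative fun j hj =>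
    (natDegree_derivative_le _).trans (Nat.sub_le_sub_right (hdeg j hj) 1)) fun x hx => ?_
  simpa [iteratedDerivWithin_one] using hder 1 (by omega) x hx

/-- Needed for `crossFun`, whose coefficients are affine along an edge. -/
theorem affine_mul_mem_splineSpace {d r k : ℕ} {f : ℝ → ℝ} (hf : f ∈ splineSpace d r k)
    (a b : ℝ) : (fun x => (a + b * x) * f x) ∈ splineSpace (d + 1) r k := by
  refine ⟨(by fun_prop : ContDiff ℝ r fun x : ℝ => a + b * x).contDiffOn.mul hf.1, fun j hj => ?_⟩
  obtain ⟨P, hP, h⟩ := hf.2 j hj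
  refine ⟨(C a + C b * X) * P, ?_, fun x hx => by simp [h x hx]⟩
  refine natDegree_mul_le.trans ?_
  have : (C a + C b * X).natDegree ≤ 1 := by
    rw [add_comm]; exact natDegree_linear_le
  omega

/-- Splines are smooth near the end points, relative to the interval. -/
theorem contDiffWithinAt_endpoint {d r k : ℕ} (hk : 0 < k) {f : ℝ → ℝ}
    (hf : f ∈ splineSpace d r k) {n : WithTop ℕ∞} {x : ℝ} (hx : x = 0 ∨ x = 1) :
    ContDiffWithinAt ℝ n f (Icc 0 1) x := by
  have hk' : (0 : ℝ) < k := by exact_mod_cast hk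
  have hpoly : ∀ P : ℝ[X], ContDiff ℝ n fun x => P.eval x := fun P => by
    simpa using P.contDiff_aeval (𝕜 := ℝ) n
  rcases hx with rfl | rfl
  · obtain ⟨P, -, hPf⟩ := hf.2 0 hk
    refine (hpoly P).contDiffAt.contDiffWithinAt.congr_of_eventuallyEq ?_
      (hPf _ ⟨by simp, by positivity⟩)
    filter_upwards [self_mem_nhdsWithin, mem_nhdsWithin_of_mem_nhds
      (Iio_mem_nhds (show (0 : ℝ) < 1 / k by positivity))] with y h1 h2
    exact hPf y ⟨by simpa using h1.1, by simpa using (show y < 1 / (k : ℝ) from h2).le⟩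
  · obtain ⟨P, -, hPf⟩ := hf.2 (k - 1) (by omega)
    rw [Nat.cast_sub hk, Nat.cast_one, sub_add_cancel, node_self hk] at hPf
    have hlt : ((k : ℝ) - 1) / k < 1 := by rw [div_lt_one hk']; linarith
    refine (hpoly P).contDiffAt.contDiffWithinAt.congr_of_eventuallyEq ?_
      (hPf _ ⟨hlt.le, le_rfl⟩)
    filter_upwards [self_mem_nhdsWithin, mem_nhdsWithin_of_mem_nhds (Ioi_mem_nhds hlt)]
      with y h1 h2
    exact hPf y ⟨le_of_lt h2, h1.2⟩

end SplineElement

namespace SplineElement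

open Set

/-! ### Tensor-product splines -/

/-- The unit square. -/
def unitSquare : Set (ℝ × ℝ) := Icc (0 : ℝ) 1 ×ˢ Icc (0 : ℝ) 1

theorem tensor_slice_fst {p r k : ℕ} {s : ℝ × ℝ → ℝ} (hs : s ∈ tensorSplineSpace p r k) (y : ℝ) :
    (fun x => s (x, y)) ∈ splineSpace p r k := by
  induction hs using Submodule.span_induction with
  | mem s h =>
    obtain ⟨f, hf, g, -, rfl⟩ := h
    have := (splineSpace p r k).smul_mem (g y) hf
    exact splineSpace_congr this fun x _ => mul_comm _ _
  | zero => exact (splineSpace p r k).zero_mem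
  | add s t _ _ h1 h2 => exact (splineSpace p r k).add_mem h1 h2
  | smul c s _ h => exact (splineSpace p r k).smul_mem c h

theorem tensor_slice_snd {p r k : ℕ} {s : ℝ × ℝ → ℝ} (hs : s ∈ tensorSplineSpace p r k) (x : ℝ) :
    (fun y => s (x, y)) ∈ splineSpace p r k := by
  induction hs using Submodule.span_induction with
  | mem s h =>
    obtain ⟨f, -, g, hg, rfl⟩ := h
    exact (splineSpace p r k).smul_mem (f x) hg
  | zero => exact (splineSpace p r k).zero_mem
  | add s t _ _ h1 h2 => exact (splineSpace p r k).add_mem h1 h2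
  | smul c s _ h => exact (splineSpace p r k).smul_mem c h

/-- Smoothness of the factors is required only at the two coordinates of `ξ`; at a corner it holds
to any order, beyond the regularity `r` of the space. -/
theorem tensor_contDiffWithinAt {p r k : ℕ} {s : ℝ × ℝ → ℝ} (hs : s ∈ tensorSplineSpace p r k)
    {n : WithTop ℕ∞} {ξ : ℝ × ℝ}
    (h : ∀ f ∈ splineSpace p r k, ContDiffWithinAt ℝ n f (Icc 0 1) ξ.1 ∧
      ContDiffWithinAt ℝ n f (Icc 0 1) ξ.2) :
    ContDiffWithinAt ℝ n s unitSquare ξ := by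
  induction hs using Submodule.span_induction with
  | mem s hs =>
    obtain ⟨f, hf, g, hg, rfl⟩ := hs
    exact ((h f hf).1.comp ξ contDiffWithinAt_fst fun z hz => hz.1).mul
      ((h g hg).2.comp ξ contDiffWithinAt_snd fun z hz => hz.2)
  | zero => exact contDiffWithinAt_const
  | add s t _ _ h1 h2 => exact h1.add h2
  | smul c s _ h => exact h.const_smul c

theorem tensor_contDiffOn {p r k : ℕ} {s : ℝ × ℝ → ℝ} (hs : s ∈ tensorSplineSpace p r k) :
    ContDiffOn ℝ r s unitSquare := fun ξ hξ =>
  tensor_contDiffWithinAt hs fun _ hf => ⟨hf.1 ξ.1 hξ.1, hf.1 ξ.2 hξ.2⟩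

/-- The functionals of the univariate interpolation problem for splines of regularity `p - 2`: values
and derivatives at the end points, and values at the interior Greville abscissae. -/
noncomputable def nodal (p k : ℕ) (f : ℝ → ℝ) : Fin 4 ⊕ Fin (2 * k + p - 5) → ℝ
  | .inl a => ![f 0, f 1, derivWithin f (Icc 0 1) 0, derivWithin f (Icc 0 1) 1] a
  | .inr j => f (theta p k (j + 2))

/-! ### Interpolation by tensor-product splines -/

section Nodal

variable {p k : ℕ}

theorem eq_zero_of_nodal_eq_zero (hp : 3 ≤ p) (hk : 0 < k) {f : ℝ → ℝ}
    (hf : f ∈ splineSpace p (p - 2) k) (h : ∀ i, nodal p k f i = 0) :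
    ∀ x ∈ Icc (0 : ℝ) 1, f x = 0 := by
  refine spline_eq_zero (μ := 2) (m := 2) hk (by omega) (by omega) (by omega) (by omega) (by omega)
    hf ?_ ?_ ?_
  · intro l hl
    interval_cases l
    · rw [iteratedDerivWithin_zero]; exact h (.inl 0)
    · rw [iteratedDerivWithin_one]; exact h (.inl 2)
  · intro l hl
    interval_cases l
    · rw [iteratedDerivWithin_zero]; exact h (.inl 1)
    · rw [iteratedDerivWithin_one]; exact h (.inl 3)
  · intro i h1 h2
    have := h (.inr ⟨i - 2, by omega⟩)
    simpa [nodal, theta, Nat.sub_add_cancel h1] using this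

theorem exists_nodal_eq (hp : 3 ≤ p) (hk : 0 < k) (hpk : 5 ≤ 2 * k + p)
    (c : Fin 4 ⊕ Fin (2 * k + p - 5) → ℝ) :
    ∃ f ∈ splineSpace p (p - 2) k, ∀ i, nodal p k f i = c i := by
  obtain ⟨f, hf, h0, h1, hz⟩ := exists_spline (d := p) (r := p - 2) (μ := 2) (m := 2)
    (n := 2 * k + p - 5) hk (by omega) (by omega) (by omega) (by omega) (by omega) (by omega)
    ![c (.inl 0), c (.inl 2)] ![c (.inl 1), c (.inl 3)] (fun j => c (.inr j))
  refine ⟨f, hf, ?_⟩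
  rintro (a | j)
  · fin_cases a
    · simpa [nodal] using h0 0
    · simpa [nodal] using h1 0
    · simpa [nodal, iteratedDerivWithin_one] using h0 1
    · simpa [nodal, iteratedDerivWithin_one] using h1 1
  · exact hz j

theorem nodal_sum (hp : 3 ≤ p) {ι : Type*} (t : Finset ι) {B : ι → ℝ → ℝ}
    (hB : ∀ i, B i ∈ splineSpace p (p - 2) k) (c : ι → ℝ) (j : Fin 4 ⊕ Fin (2 * k + p - 5)) :
    nodal p k (fun x => ∑ i ∈ t, c i * B i x) j = ∑ i ∈ t, c i * nodal p k (B i) j := by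
  have hder : ∀ x ∈ Icc (0 : ℝ) 1, derivWithin (fun x => ∑ i ∈ t, c i * B i x) (Icc 0 1) x =
      ∑ i ∈ t, c i * derivWithin (B i) (Icc 0 1) x := by
    intro x hx
    refine (HasDerivWithinAt.fun_sum fun i _ => ?_).derivWithin (uniqueDiffOn_unitInterval x hx)
    refine HasDerivWithinAt.const_mul _ (DifferentiableWithinAt.hasDerivWithinAt ?_)
    exact ((hB i).1.differentiableOn (by
      have : p - 2 ≠ 0 := by omega
      exact_mod_cast this)) x hx
  rcases j with a | j
  · fin_cases a
    · simp [nodal]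
    · simp [nodal]
    · simpa [nodal] using hder 0 ⟨le_rfl, zero_le_one⟩
    · simpa [nodal] using hder 1 ⟨zero_le_one, le_rfl⟩
  · simp [nodal]

/-- Univariate uniqueness is used twice: `s` vanishes on the lines `y = θ_j`, hence on every line of
constant `x`. -/
theorem tensor_eq_zero (hp : 3 ≤ p) (hk : 0 < k) {s : ℝ × ℝ → ℝ}
    (hs : s ∈ tensorSplineSpace p (p - 2) k)
    (hX : ∀ x ∈ Icc (0 : ℝ) 1, ∀ b, nodal p k (fun y => s (x, y)) (.inl b) = 0)
    (hY : ∀ y ∈ Icc (0 : ℝ) 1, ∀ a, nodal p k (fun x => s (x, y)) (.inl a) = 0)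
    (hz : ∀ i j : Fin (2 * k + p - 5), s (theta p k (i + 2), theta p k (j + 2)) = 0) :
    ∀ ξ ∈ unitSquare, s ξ = 0 := by
  rintro ⟨x, y⟩ ⟨hx, hy⟩
  refine eq_zero_of_nodal_eq_zero hp hk (tensor_slice_snd hs x) ?_ y hy
  rintro (b | j)
  · exact hX x hx b
  · refine eq_zero_of_nodal_eq_zero hp hk (tensor_slice_fst hs (theta p k (j + 2))) ?_ x hx
    rintro (a | i)
    · exact hY _ greville_mem a
    · exact hz i j

/-- In the basis dual to `nodal`, `X` prescribes four columns and `Y` four rows of the coefficient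
matrix of `s`, and `c` the rest. `hXY` is agreement on the sixteen shared entries. -/
theorem exists_tensor (hp : 3 ≤ p) (hk : 0 < k) (hpk : 5 ≤ 2 * k + p) {X Y : Fin 4 → ℝ → ℝ}
    (hX : ∀ b, X b ∈ splineSpace p (p - 2) k) (hY : ∀ a, Y a ∈ splineSpace p (p - 2) k)
    (hXY : ∀ a b, nodal p k (X b) (.inl a) = nodal p k (Y a) (.inl b))
    (c : Fin (2 * k + p - 5) → Fin (2 * k + p - 5) → ℝ) :
    ∃ s ∈ tensorSplineSpace p (p - 2) k,
      (∀ x ∈ Icc (0 : ℝ) 1, ∀ b, nodal p k (fun y => s (x, y)) (.inl b) = X b x) ∧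
      (∀ y ∈ Icc (0 : ℝ) 1, ∀ a, nodal p k (fun x => s (x, y)) (.inl a) = Y a y) ∧
      ∀ i j : Fin (2 * k + p - 5), s (theta p k (i + 2), theta p k (j + 2)) = c i j := by
  classical
  have hB' := fun i => exists_nodal_eq hp hk hpk (Pi.single i (1 : ℝ))
  choose B hB hBδ using hB'
  have hexp : ∀ f ∈ splineSpace p (p - 2) k, ∀ x ∈ Icc (0 : ℝ) 1,
      ∑ i, nodal p k f i * B i x = f x := by
    intro f hf x hx
    obtain ⟨g, hgdef⟩ : ∃ g : ℝ → ℝ, ∀ x, g x = ∑ i, nodal p k f i * B i x := ⟨_, fun _ => rfl⟩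
    have hgf : g = fun x => ∑ i, nodal p k f i * B i x := funext hgdef
    have hg : g ∈ splineSpace p (p - 2) k := by
      have := Submodule.sum_mem (splineSpace p (p - 2) k) (t := Finset.univ)
        fun i _ => (splineSpace p (p - 2) k).smul_mem (nodal p k f i) (hB i)
      refine splineSpace_congr this fun x _ => ?_
      rw [hgdef, Finset.sum_apply]
      rfl
    rw [← hgdef, ← sub_eq_zero]
    refine eq_zero_of_nodal_eq_zero hp hk ((splineSpace p (p - 2) k).sub_mem hg hf)
      (fun j => ?_) x hx
    -- The difference `g - f` as a combination over `Bool` with coefficients `1` and `-1`.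
    have h2 := nodal_sum hp Finset.univ (B := fun b : Bool => bif b then g else f)
      (fun b => by cases b <;> simpa) (fun b => bif b then 1 else -1) j
    simp only [Fintype.univ_bool, Finset.mem_singleton, Bool.true_eq_false, not_false_eq_true,
      Finset.sum_insert, cond_true, one_mul, Finset.sum_singleton, cond_false, neg_mul,
      ← sub_eq_add_neg] at h2
    rw [show g - f = fun x => g x - f x from rfl, h2, hgf, nodal_sum hp _ hB]
    simp [hBδ, Pi.single_apply]
  -- The shared entries are taken from `X`; `hC` uses `hXY` to read them from `Y` as well.
  let C : Fin 4 ⊕ Fin (2 * k + p - 5) → Fin 4 ⊕ Fin (2 * k + p - 5) → ℝ := fun i j =>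
    match i, j with
    | i, .inl b => nodal p k (X b) i
    | .inl a, .inr j => nodal p k (Y a) (.inr j)
    | .inr i, .inr j => c i j
  have hC : ∀ a j, C (.inl a) j = nodal p k (Y a) j := by
    rintro a (b | j)
    · exact hXY a b
    · rfl
  have hs2 : ∀ x j, nodal p k (fun y => ∑ i, ∑ j, C i j * (B i x * B j y)) j =
      ∑ i, C i j * B i x := by
    intro x j
    have := nodal_sum hp Finset.univ hB (fun j => ∑ i, C i j * B i x) j
    simp only [hBδ, Pi.single_apply, mul_ite, mul_one, mul_zero, Finset.sum_ite_eq,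
      Finset.mem_univ, if_true] at this
    rw [← this]
    congr 1
    funext y
    rw [Finset.sum_comm]
    simp only [Finset.sum_mul, mul_assoc]
  have hs1 : ∀ y i, nodal p k (fun x => ∑ i, ∑ j, C i j * (B i x * B j y)) i =
      ∑ j, C i j * B j y := by
    intro y i
    have := nodal_sum hp Finset.univ hB (fun i => ∑ j, C i j * B j y) i
    simp only [hBδ, Pi.single_apply, mul_ite, mul_one, mul_zero, Finset.sum_ite_eq,
      Finset.mem_univ, if_true] at this
    rw [← this]
    congr 1
    funext x
    refine Finset.sum_congr rfl fun i _ => ?_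
    rw [Finset.sum_mul]
    exact Finset.sum_congr rfl fun j _ => by ring
  refine ⟨fun ξ => ∑ i, ∑ j, C i j * (B i ξ.1 * B j ξ.2), ?_, ?_, ?_, ?_⟩
  · have := Submodule.sum_mem (tensorSplineSpace p (p - 2) k) (t := Finset.univ)
      (f := fun i => ∑ j, C i j • fun ξ : ℝ × ℝ => B i ξ.1 * B j ξ.2)
      fun i _ => Submodule.sum_mem _ fun j _ => Submodule.smul_mem _ _
        (Submodule.subset_span ⟨B i, hB i, B j, hB j, rfl⟩)
    convert this using 1
    funext ξ
    simp
  · intro x hx b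
    rw [hs2]
    exact hexp _ (hX b) x hx
  · intro y hy a
    rw [hs1]
    simp only [hC]
    exact hexp _ (hY a) y hy
  · intro i j
    have h2 : ∀ l, B l (theta p k (i + 2)) = if l = Sum.inr i then 1 else 0 := fun l => by
      simpa [nodal, Pi.single_apply, eq_comm] using hBδ l (.inr i)
    refine (hs2 (theta p k (i + 2)) (.inr j)).trans ?_
    simp only [h2, mul_ite, mul_one, mul_zero, Finset.sum_ite_eq', Finset.mem_univ, if_true, C]

end Nodal

end SplineElement

namespace SplineElement

open Set Topology

/-! ### Geometry of the bilinear parametrization -/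

theorem det₂_smul_add_left (a b c : Plane) (s t : ℝ) :
    det₂ (s • a + t • b) c = s * det₂ a c + t * det₂ b c := by
  simp [det₂]; ring

theorem det₂_smul_add_right (a b c : Plane) (s t : ℝ) :
    det₂ c (s • a + t • b) = s * det₂ c a + t * det₂ c b := by
  simp [det₂]; ring

theorem det₂_self (a : Plane) : det₂ a a = 0 := by simp [det₂]; ring

/-- Cramer's rule in the plane. -/
theorem det₂_smul_eq (a b c : Plane) : det₂ a b • c = det₂ c b • a + det₂ a c • b := by
  ext i
  fin_cases i <;> simp [det₂] <;> ring

theorem eq_zero_of_smul_add_smul {a b : Plane} (h : det₂ a b ≠ 0) {s t : ℝ}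
    (hst : s • a + t • b = 0) : s = 0 ∧ t = 0 := by
  have h1 : det₂ (s • a + t • b) b = 0 := by rw [hst]; simp [det₂]
  have h2 : det₂ a (s • a + t • b) = 0 := by rw [hst]; simp [det₂]
  rw [det₂_smul_add_left, det₂_self] at h1
  rw [det₂_smul_add_right, det₂_self] at h2
  exact ⟨by simpa [h] using h1, by simpa [h] using h2⟩

theorem fin_four_add_one_add_one (i : Fin 4) : i + 1 + 1 = i + 2 := by
  rw [add_assoc]; rfl

namespace Quadrilateral

variable (Q : Quadrilateral)

/-- The derivative of the parametrization across the `i`-th edge, towards the interior. -/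
noncomputable def crossVec (i : Fin 4) (t : ℝ) : Plane :=
  (1 - t) • (Q.vertex (i - 1) - Q.vertex i) + t • (Q.vertex (i + 2) - Q.vertex (i + 1))

theorem crossVec_zero (i : Fin 4) : Q.crossVec i 0 = - edgeVec Q.vertex (i - 1) := by
  simp [crossVec, edgeVec]

theorem crossVec_one (i : Fin 4) : Q.crossVec i 1 = edgeVec Q.vertex (i + 1) := by
  simp [crossVec, edgeVec, fin_four_add_one_add_one]

theorem crossVec_eq (i : Fin 4) (t : ℝ) :
    Q.crossVec i t = (1 - t) • Q.crossVec i 0 + t • Q.crossVec i 1 := by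
  simp [crossVec]

theorem det₂_edge_crossVec_zero (i : Fin 4) :
    0 < det₂ (edgeVec Q.vertex i) (Q.crossVec i 0) := by
  have := Q.convex_ccw i
  rw [crossVec_zero]
  simp only [det₂, PiLp.neg_apply] at this ⊢
  linarith

theorem det₂_edge_crossVec_one (i : Fin 4) :
    0 < det₂ (edgeVec Q.vertex i) (Q.crossVec i 1) := by
  have := Q.convex_ccw (i + 1)
  rw [add_sub_cancel_right] at this
  rwa [crossVec_one]

theorem convexCombination_pos {a b t : ℝ} (ha : 0 < a) (hb : 0 < b) (ht : t ∈ Icc (0 : ℝ) 1) :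
    0 < (1 - t) * a + t * b := by
  rcases ht.2.lt_or_eq with h | rfl
  · have := mul_pos (sub_pos.2 h) ha
    have := mul_nonneg ht.1 hb.le
    linarith
  · simpa

theorem det₂_edge_crossVec_pos (i : Fin 4) {t : ℝ} (ht : t ∈ Icc (0 : ℝ) 1) :
    0 < det₂ (edgeVec Q.vertex i) (Q.crossVec i t) := by
  rw [crossVec_eq, det₂_smul_add_right]
  exact convexCombination_pos (Q.det₂_edge_crossVec_zero i) (Q.det₂_edge_crossVec_one i) ht

/-- The derivative of the parametrization in the first parameter, at parameter `y` of the second. -/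
noncomputable def tangentFst (y : ℝ) : Plane :=
  (1 - y) • (Q.vertex 1 - Q.vertex 0) + y • (Q.vertex 2 - Q.vertex 3)

/-- The derivative of the parametrization in the second parameter, at parameter `x` of the first. -/
noncomputable def tangentSnd (x : ℝ) : Plane :=
  (1 - x) • (Q.vertex 3 - Q.vertex 0) + x • (Q.vertex 2 - Q.vertex 1)

/-- The Jacobian determinant is affine in each variable, and its corner values are the four
determinants of `convex_ccw`. -/
theorem det₂_tangent_pos {x y : ℝ} (hx : x ∈ Icc (0 : ℝ) 1) (hy : y ∈ Icc (0 : ℝ) 1) :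
    0 < det₂ (Q.tangentFst y) (Q.tangentSnd x) := by
  have h0 := Q.convex_ccw 0
  have h1 := Q.convex_ccw 1
  have h2 := Q.convex_ccw 2
  have h3 := Q.convex_ccw 3
  simp only [edgeVec, zero_sub, sub_self, zero_add,
    show (-1 : Fin 4) = 3 from rfl, show (3 + 1 : Fin 4) = 0 from rfl,
    show (1 + 1 : Fin 4) = 2 from rfl, show (2 + 1 : Fin 4) = 3 from rfl,
    show (2 - 1 : Fin 4) = 1 from rfl, show (3 - 1 : Fin 4) = 2 from rfl] at h0 h1 h2 h3
  rw [tangentFst, tangentSnd, det₂_smul_add_left, det₂_smul_add_right, det₂_smul_add_right]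
  refine convexCombination_pos (convexCombination_pos ?_ ?_ hx) (convexCombination_pos ?_ ?_ hx) hy
  all_goals
    simp only [det₂, PiLp.sub_apply] at h0 h1 h2 h3 ⊢
    linarith

/-- The derivative of the parametrization. -/
noncomputable def paramDeriv (ξ : ℝ × ℝ) : ℝ × ℝ →L[ℝ] Plane :=
  (ContinuousLinearMap.fst ℝ ℝ ℝ).smulRight (Q.tangentFst ξ.2) +
    (ContinuousLinearMap.snd ℝ ℝ ℝ).smulRight (Q.tangentSnd ξ.1)

theorem paramDeriv_apply (ξ w : ℝ × ℝ) :
    Q.paramDeriv ξ w = w.1 • Q.tangentFst ξ.2 + w.2 • Q.tangentSnd ξ.1 := by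
  simp [paramDeriv]

/-- For a quadratic map the mean value formula with the derivative at the midpoint is exact. As the
square is convex, injectivity of the derivative gives injectivity of `param`. -/
theorem param_sub (ξ ζ : ℝ × ℝ) :
    Q.param ξ - Q.param ζ = Q.paramDeriv ((1 / 2 : ℝ) • (ξ + ζ)) (ξ - ζ) := by
  rw [paramDeriv_apply]
  ext i
  simp [param, tangentFst, tangentSnd]
  ring

theorem contDiff_param {n : WithTop ℕ∞} : ContDiff ℝ n Q.param := by
  unfold param
  fun_prop

theorem hasFDerivAt_param (ξ : ℝ × ℝ) : HasFDerivAt Q.param (Q.paramDeriv ξ) ξ := by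
  have h1 : HasFDerivAt (fun ξ : ℝ × ℝ => ξ.1) (ContinuousLinearMap.fst ℝ ℝ ℝ) ξ := hasFDerivAt_fst
  have h2 : HasFDerivAt (fun ξ : ℝ × ℝ => ξ.2) (ContinuousLinearMap.snd ℝ ℝ ℝ) ξ := hasFDerivAt_snd
  have h := (((((h1.const_sub 1).mul (h2.const_sub 1)).smul_const (Q.vertex 0)).add
    ((h1.mul (h2.const_sub 1)).smul_const (Q.vertex 1))).add
    ((h1.mul h2).smul_const (Q.vertex 2))).add
    (((h1.const_sub 1).mul h2).smul_const (Q.vertex 3))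
  refine h.congr_fderiv (ContinuousLinearMap.ext fun w => ?_)
  ext i
  simp [paramDeriv_apply, tangentFst, tangentSnd]
  ring

theorem injective_paramDeriv {ξ : ℝ × ℝ} (hξ : ξ ∈ unitSquare) :
    Function.Injective (Q.paramDeriv ξ) := by
  rw [injective_iff_map_eq_zero]
  intro w hw
  rw [paramDeriv_apply] at hw
  obtain ⟨h1, h2⟩ := eq_zero_of_smul_add_smul (Q.det₂_tangent_pos hξ.1 hξ.2).ne' hw
  exact Prod.ext h1 h2

theorem exists_equiv_paramDeriv {ξ : ℝ × ℝ} (hξ : ξ ∈ unitSquare) :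
    ∃ e : (ℝ × ℝ) ≃L[ℝ] Plane, (e : ℝ × ℝ →L[ℝ] Plane) = Q.paramDeriv ξ := by
  have hdim : Module.finrank ℝ (ℝ × ℝ) = Module.finrank ℝ Plane := by simp
  refine ⟨(LinearMap.linearEquivOfInjective (Q.paramDeriv ξ : ℝ × ℝ →ₗ[ℝ] Plane)
    (Q.injective_paramDeriv hξ) hdim).toContinuousLinearEquiv, ?_⟩
  ext w <;> simp

theorem convex_unitSquare : Convex ℝ unitSquare := (convex_Icc 0 1).prod (convex_Icc 0 1)

theorem isCompact_unitSquare : IsCompact unitSquare := isCompact_Icc.prod isCompact_Icc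

theorem injOn_param : InjOn Q.param unitSquare := by
  intro ξ hξ ζ hζ h
  have hmid : (1 / 2 : ℝ) • (ξ + ζ) ∈ unitSquare := by
    rw [smul_add]
    exact convex_unitSquare hξ hζ (by norm_num) (by norm_num) (by norm_num)
  have := Q.param_sub ξ ζ
  rw [h, sub_self] at this
  exact sub_eq_zero.1 ((injective_iff_map_eq_zero _).1 (Q.injective_paramDeriv hmid) _ this.symm)

theorem mapsTo_param : MapsTo Q.param unitSquare Q.closedSet := by
  rintro ⟨x, y⟩ ⟨⟨hx0, hx1⟩, hy0, hy1⟩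
  have hv : ∀ i, Q.vertex i ∈ Q.closedSet := fun i => subset_convexHull ℝ _ (mem_range_self i)
  have hc : Convex ℝ Q.closedSet := convex_convexHull ℝ _
  have h1 := hc (hv 0) (hv 1) (sub_nonneg.2 hx1) hx0 (by ring)
  have h2 := hc (hv 3) (hv 2) (sub_nonneg.2 hx1) hx0 (by ring)
  have h3 := hc h1 h2 (sub_nonneg.2 hy1) hy0 (by ring)
  convert h3 using 1
  ext i
  simp [param]
  ring

/-- A half-plane is convex, so only vertices matter: two lie on the edge, and the other two give the
convexity determinants at its ends. -/
theorem det₂_edge_nonneg {z : Plane} (hz : z ∈ Q.closedSet) (i : Fin 4) :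
    0 ≤ det₂ (edgeVec Q.vertex i) (z - Q.vertex i) := by
  have hconv : Convex ℝ {z : Plane | 0 ≤ det₂ (edgeVec Q.vertex i) (z - Q.vertex i)} := by
    intro z hz w hw a b ha hb hab
    have : a • z + b • w - Q.vertex i = a • (z - Q.vertex i) + b • (w - Q.vertex i) := by
      rw [smul_sub, smul_sub, sub_add_sub_comm, ← add_smul, hab, one_smul]
    simp only [mem_ofPred_eq] at hz hw ⊢
    rw [this, det₂_smul_add_right]
    positivity
  refine convexHull_min ?_ hconv hz
  rintro _ ⟨j, rfl⟩
  obtain ⟨l, rfl⟩ : ∃ l, j = i + l := ⟨j - i, by abel⟩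
  have h0 := Q.convex_ccw i
  have h1 := Q.convex_ccw (i + 1)
  simp only [edgeVec, sub_add_cancel, add_sub_cancel_right, det₂, PiLp.sub_apply] at h0 h1
  rw [fin_four_add_one_add_one] at h1
  fin_cases l
  · simp [det₂]
  · simp [det₂, edgeVec]; ring_nf; simp
  · simp [det₂, edgeVec]; linarith
  · have : i + 3 = i - 1 := by rw [sub_eq_add_neg]; rfl
    simp [det₂, edgeVec, this]; linarith

theorem surjOn_param : SurjOn Q.param unitSquare Q.closedSet := by
  intro z hz
  have h0 := Q.det₂_edge_nonneg hz 0
  have h1 := Q.det₂_edge_nonneg hz 1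
  have h2 := Q.det₂_edge_nonneg hz 2
  have h3 := Q.det₂_edge_nonneg hz 3
  have c0 := Q.convex_ccw 0
  have c1 := Q.convex_ccw 1
  have c2 := Q.convex_ccw 2
  have c3 := Q.convex_ccw 3
  simp only [edgeVec, zero_sub, sub_self, zero_add,
    show (-1 : Fin 4) = 3 from rfl, show (3 + 1 : Fin 4) = 0 from rfl,
    show (1 + 1 : Fin 4) = 2 from rfl, show (2 + 1 : Fin 4) = 3 from rfl,
    show (2 - 1 : Fin 4) = 1 from rfl, show (3 - 1 : Fin 4) = 2 from rfl, det₂,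
    PiLp.sub_apply] at h0 h1 h2 h3 c0 c1 c2 c3
  -- `ψ x` tells the side of `z` relative to the image of the parameter line with first coordinate
  -- `x`. It is nonpositive on edge `3` and nonnegative on edge `1`, so some such line passes
  -- through `z`.
  let ψ : ℝ → ℝ := fun x => det₂ (Q.tangentSnd x)
    (z - ((1 - x) • Q.vertex 0 + x • Q.vertex 1))
  have hψ : ContinuousOn ψ (Icc 0 1) := by
    refine Continuous.continuousOn ?_
    simp only [ψ, det₂, tangentSnd, PiLp.sub_apply, PiLp.add_apply, PiLp.smul_apply, smul_eq_mul]
    fun_prop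
  obtain ⟨x, hx, hx0⟩ : ∃ x ∈ Icc (0 : ℝ) 1, ψ x = 0 := by
    refine intermediate_value_Icc zero_le_one hψ ⟨?_, ?_⟩
    · simp [ψ, det₂, tangentSnd]
      linarith
    · simp [ψ, det₂, tangentSnd]
      linarith
  set a : Plane := (1 - x) • Q.vertex 0 + x • Q.vertex 1 with ha
  have hd : 0 < det₂ (Q.tangentFst 0) (Q.tangentSnd x) :=
    Q.det₂_tangent_pos hx ⟨le_rfl, zero_le_one⟩
  have hd' : 0 < det₂ (Q.tangentFst 1) (Q.tangentSnd x) :=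
    Q.det₂_tangent_pos hx ⟨zero_le_one, le_rfl⟩
  -- The position of `z` on that line; edges `0` and `2` bound it by `0` and `1`.
  set τ := det₂ (Q.tangentFst 0) (z - a) / det₂ (Q.tangentFst 0) (Q.tangentSnd x) with hτ
  have hza : z - a = τ • Q.tangentSnd x := by
    have h := det₂_smul_eq (Q.tangentFst 0) (Q.tangentSnd x) (z - a)
    have : det₂ (z - a) (Q.tangentSnd x) = 0 := by
      have : ψ x = - det₂ (z - a) (Q.tangentSnd x) := by simp only [ψ, det₂, ha]; ring
      linarith
    rw [this, zero_smul, zero_add] at h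
    rw [hτ, div_eq_inv_mul, mul_smul, ← h, inv_smul_smul₀ hd.ne']
  have hτ0 : 0 ≤ τ := by
    refine div_nonneg ?_ hd.le
    simp [ha, det₂, tangentFst]
    nlinarith
  have hτ1 : 0 ≤ 1 - τ := by
    have e : (1 - τ) * det₂ (Q.tangentFst 1) (Q.tangentSnd x) =
        det₂ (Q.tangentFst 1) (Q.tangentSnd x - (z - a)) := by
      rw [hza]; simp [det₂]; ring
    have e2 : 0 ≤ det₂ (Q.tangentFst 1) (Q.tangentSnd x - (z - a)) := by
      simp [ha, det₂, tangentFst, tangentSnd]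
      nlinarith
    exact nonneg_of_mul_nonneg_left (e ▸ e2) hd'
  refine ⟨(x, τ), ⟨hx, hτ0, by linarith⟩, ?_⟩
  rw [sub_eq_iff_eq_add.1 hza, ha]
  ext i
  simp [param, tangentSnd]
  ring

/-- The inverse of the bilinear parametrization. -/
noncomputable def invParam : Plane → ℝ × ℝ := Function.invFunOn Q.param unitSquare

theorem invParam_mem {z : Plane} (hz : z ∈ Q.closedSet) : Q.invParam z ∈ unitSquare :=
  Function.invFunOn_mem (Q.surjOn_param hz)

theorem param_invParam {z : Plane} (hz : z ∈ Q.closedSet) : Q.param (Q.invParam z) = z :=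
  Function.invFunOn_eq (Q.surjOn_param hz)

theorem invParam_param {ξ : ℝ × ℝ} (hξ : ξ ∈ unitSquare) : Q.invParam (Q.param ξ) = ξ :=
  Q.injOn_param.leftInvOn_invFunOn hξ

/-- A continuous injection on a compact set is closed. -/
theorem continuousOn_invParam : ContinuousOn Q.invParam Q.closedSet := by
  rw [continuousOn_iff_isClosed]
  intro t ht
  have hc : IsCompact (unitSquare ∩ t) := isCompact_unitSquare.inter_right ht
  refine ⟨Q.param '' (unitSquare ∩ t),
    (hc.image (Q.contDiff_param (n := 0)).continuous).isClosed, ?_⟩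
  ext z
  constructor
  · rintro ⟨h1, h2⟩
    exact ⟨⟨Q.invParam z, ⟨Q.invParam_mem h2, h1⟩, Q.param_invParam h2⟩, h2⟩
  · rintro ⟨⟨ξ, ⟨h1, h2⟩, rfl⟩, h3⟩
    exact ⟨by rwa [mem_preimage, Q.invParam_param h1], h3⟩

/-- `param` is smooth on the whole plane with invertible derivative on the closed square, so the
inverse function theorem applies at boundary points too. Continuity of `invParam` identifies it with
the local inverse. -/
theorem contDiffOn_invParam {n : WithTop ℕ∞} (hn : n ≠ 0) :
    ContDiffOn ℝ n Q.invParam Q.closedSet := by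
  intro z hz
  have hξ := Q.invParam_mem hz
  obtain ⟨e, he⟩ := Q.exists_equiv_paramDeriv hξ
  have hF : ContDiffAt ℝ n Q.param (Q.invParam z) := Q.contDiff_param.contDiffAt
  have hF' : HasFDerivAt Q.param (e : ℝ × ℝ →L[ℝ] Plane) (Q.invParam z) :=
    he ▸ Q.hasFDerivAt_param _
  have hL := hF.to_localInverse hF' hn
  rw [Q.param_invParam hz] at hL
  have hleft : ∀ᶠ ζ in 𝓝 (Q.invParam z), hF.localInverse hF' hn (Q.param ζ) = ζ :=
    (hF.toOpenPartialHomeomorph Q.param hF' hn).eventually_left_inverse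
      (hF.mem_toOpenPartialHomeomorph_source hF' hn)
  refine hL.contDiffWithinAt.congr_of_eventuallyEq ?_ ?_
  · filter_upwards [(Q.continuousOn_invParam z hz).eventually hleft, self_mem_nhdsWithin]
      with w h1 h2
    rw [← h1, Q.param_invParam h2]
  · have := hleft.self_of_nhds
    rw [Q.param_invParam hz] at this
    exact this.symm

end Quadrilateral

end SplineElement

namespace SplineElement

open Set Topology

namespace Quadrilateral

variable (Q : Quadrilateral)

theorem convex_closedSet : Convex ℝ Q.closedSet := convex_convexHull ℝ _

theorem vertex_mem (i : Fin 4) : Q.vertex i ∈ Q.closedSet :=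
  subset_convexHull ℝ _ (mem_range_self i)

/-- For a convex set this yields unique derivatives at all its points, the vertices included. -/
theorem interior_closedSet_nonempty : (interior Q.closedSet).Nonempty := by
  have hmem : ((1 / 2, 1 / 2) : ℝ × ℝ) ∈ unitSquare := by
    constructor <;> constructor <;> norm_num
  obtain ⟨e, he⟩ := Q.exists_equiv_paramDeriv hmem
  have hF : HasStrictFDerivAt Q.param (e : ℝ × ℝ →L[ℝ] Plane) (1 / 2, 1 / 2) :=
    (Q.contDiff_param (n := 1)).contDiffAt.hasStrictFDerivAt' (he ▸ Q.hasFDerivAt_param _)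
      one_ne_zero
  refine ⟨Q.param (1 / 2, 1 / 2), mem_interior_iff_mem_nhds.2 ?_⟩
  rw [← hF.map_nhds_eq_of_equiv]
  refine Filter.mem_of_superset (Filter.image_mem_map ?_) Q.mapsTo_param.image_subset
  exact prod_mem_nhds (Icc_mem_nhds (by norm_num) (by norm_num))
    (Icc_mem_nhds (by norm_num) (by norm_num))

theorem uniqueDiffOn_closedSet : UniqueDiffOn ℝ Q.closedSet :=
  uniqueDiffOn_convex Q.convex_closedSet Q.interior_closedSet_nonempty

/-! ### Functions on the quadrilateral with a smooth pullback -/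

theorem contDiffWithinAt_of_pullback {n : WithTop ℕ∞} (hn : n ≠ 0) {Φ : Plane → ℝ}
    {s : ℝ × ℝ → ℝ} (hs : ∀ ξ ∈ unitSquare, Φ (Q.param ξ) = s ξ) {ξ : ℝ × ℝ} (hξ : ξ ∈ unitSquare)
    (h : ContDiffWithinAt ℝ n s unitSquare ξ) :
    ContDiffWithinAt ℝ n Φ Q.closedSet (Q.param ξ) := by
  have hz := Q.mapsTo_param hξ
  have hΦ : ∀ z ∈ Q.closedSet, Φ z = (s ∘ Q.invParam) z := fun z hz => by
    rw [Function.comp, ← hs _ (Q.invParam_mem hz), Q.param_invParam hz]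
  rw [← Q.invParam_param hξ] at h
  exact (h.comp _ (Q.contDiffOn_invParam hn _ hz) fun z => Q.invParam_mem).congr hΦ (hΦ _ hz)

theorem refEdge_mem (i : Fin 4) {t : ℝ} (ht : t ∈ Icc (0 : ℝ) 1) : refEdge i t ∈ unitSquare := by
  have h0 : (0 : ℝ) ∈ Icc (0 : ℝ) 1 := ⟨le_rfl, zero_le_one⟩
  have h1 : (1 : ℝ) ∈ Icc (0 : ℝ) 1 := ⟨zero_le_one, le_rfl⟩
  have ht' : 1 - t ∈ Icc (0 : ℝ) 1 := ⟨by linarith [ht.2], by linarith [ht.1]⟩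
  fin_cases i
  · exact ⟨ht, h0⟩
  · exact ⟨h1, ht⟩
  · exact ⟨ht', h1⟩
  · exact ⟨h0, ht'⟩

theorem edgeParam_eq (i : Fin 4) (t : ℝ) :
    Q.edgeParam i t = Q.vertex i + t • edgeVec Q.vertex i := by
  ext j
  fin_cases i <;> simp [edgeParam, refEdge, param, edgeVec] <;> ring

theorem edgeParam_zero (i : Fin 4) : Q.edgeParam i 0 = Q.vertex i := by simp [edgeParam_eq]

theorem edgeParam_one (i : Fin 4) : Q.edgeParam i 1 = Q.vertex (i + 1) := by
  simp [edgeParam_eq, edgeVec]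

theorem edgeParam_mem (i : Fin 4) {t : ℝ} (ht : t ∈ Icc (0 : ℝ) 1) :
    Q.edgeParam i t ∈ Q.closedSet := Q.mapsTo_param (refEdge_mem i ht)

theorem hasDerivWithinAt_edgeParam (i : Fin 4) (t : ℝ) :
    HasDerivWithinAt (Q.edgeParam i) (edgeVec Q.vertex i) (Icc 0 1) t := by
  have h := ((hasDerivWithinAt_id t (Icc (0 : ℝ) 1)).smul_const (edgeVec Q.vertex i)).const_add
    (Q.vertex i)
  rw [one_smul] at h
  exact h.congr (fun x _ => Q.edgeParam_eq i x) (Q.edgeParam_eq i t)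

/-- A function that is continuously differentiable on the closed quadrilateral, and twice
continuously differentiable at the vertices. -/
def IsSmooth (Φ : Plane → ℝ) : Prop :=
  ContDiffOn ℝ 1 Φ Q.closedSet ∧ ∀ i, ContDiffWithinAt ℝ 2 Φ Q.closedSet (Q.vertex i)

/-- Regularity `p - 2` may be only `1`; the second derivatives at the vertices exist because splines
are polynomials near the end points. -/
theorem isSmooth_of_pullback {p k : ℕ} (hp : 3 ≤ p) (hk : 0 < k) {Φ : Plane → ℝ} {s : ℝ × ℝ → ℝ}
    (hs : s ∈ tensorSplineSpace p (p - 2) k) (hΦ : ∀ ξ ∈ unitSquare, Φ (Q.param ξ) = s ξ) :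
    Q.IsSmooth Φ := by
  constructor
  · intro z hz
    rw [← Q.param_invParam hz]
    refine Q.contDiffWithinAt_of_pullback one_ne_zero hΦ (Q.invParam_mem hz) ?_
    have h1 : (1 : ℕ) ≤ p - 2 := by omega
    exact ((tensor_contDiffOn hs).of_le (by exact_mod_cast h1)) _ (Q.invParam_mem hz)
  · intro i
    rw [← Q.edgeParam_zero i]
    refine Q.contDiffWithinAt_of_pullback two_ne_zero hΦ (refEdge_mem i ⟨le_rfl, zero_le_one⟩)
      (tensor_contDiffWithinAt hs fun f hf => ⟨contDiffWithinAt_endpoint hk hf ?_,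
        contDiffWithinAt_endpoint hk hf ?_⟩)
    all_goals fin_cases i <;> simp [refEdge]

variable {Q} {Φ : Plane → ℝ}

theorem IsSmooth.hasFDerivWithinAt (hΦ : Q.IsSmooth Φ) {z : Plane} (hz : z ∈ Q.closedSet) :
    HasFDerivWithinAt Φ (fderivWithin ℝ Φ Q.closedSet z) Q.closedSet z :=
  (hΦ.1.differentiableOn one_ne_zero z hz).hasFDerivWithinAt

theorem IsSmooth.differentiableWithinAt_fderivWithin (hΦ : Q.IsSmooth Φ) (i : Fin 4) :
    DifferentiableWithinAt ℝ (fderivWithin ℝ Φ Q.closedSet) Q.closedSet (Q.vertex i) :=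
  ((hΦ.2 i).fderivWithin_right Q.uniqueDiffOn_closedSet (m := 1) (by norm_num)
    (Q.vertex_mem i)).differentiableWithinAt one_ne_zero

/-- The second derivative relative to the closed quadrilateral. -/
noncomputable def hess (Q : Quadrilateral) (Φ : Plane → ℝ) (z : Plane) :
    Plane →L[ℝ] Plane →L[ℝ] ℝ :=
  fderivWithin ℝ (fderivWithin ℝ Φ Q.closedSet) Q.closedSet z

/-- Schwarz's theorem at a boundary point in the closure of the interior; it is why one mixed
derivative per vertex suffices. -/
theorem IsSmooth.hess_symm (hΦ : Q.IsSmooth Φ) (i : Fin 4) (u w : Plane) :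
    Q.hess Φ (Q.vertex i) u w = Q.hess Φ (Q.vertex i) w u := by
  have hcl : Q.vertex i ∈ closure (interior Q.closedSet) := by
    rw [Q.convex_closedSet.closure_interior_eq_closure_of_nonempty_interior
      Q.interior_closedSet_nonempty]
    exact subset_closure (Q.vertex_mem i)
  exact (hΦ.2 i).isSymmSndFDerivWithinAt (by simp) Q.uniqueDiffOn_closedSet hcl
    (Q.vertex_mem i) u w

theorem IsSmooth.partialDeriv_partialDeriv (hΦ : Q.IsSmooth Φ) (i : Fin 4) (a b : Fin 2) :
    Q.partialDeriv a (Q.partialDeriv b Φ) (Q.vertex i) = Q.hess Φ (Q.vertex i)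
      (EuclideanSpace.single a 1) (EuclideanSpace.single b 1) := by
  have h := ((hΦ.differentiableWithinAt_fderivWithin i).hasFDerivWithinAt).clm_apply
    (hasFDerivWithinAt_const (EuclideanSpace.single b (1 : ℝ)) (Q.vertex i) Q.closedSet)
  have h' := h.fderivWithin (Q.uniqueDiffOn_closedSet _ (Q.vertex_mem i))
  refine (DFunLike.congr_fun h' (EuclideanSpace.single a (1 : ℝ))).trans ?_
  simp [hess]

theorem IsSmooth.hasDerivWithinAt_edge (hΦ : Q.IsSmooth Φ) (i : Fin 4) {t : ℝ}
    (ht : t ∈ Icc (0 : ℝ) 1) : HasDerivWithinAt (fun t => Φ (Q.edgeParam i t))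
      (Q.dirDeriv (edgeVec Q.vertex i) Φ (Q.edgeParam i t)) (Icc 0 1) t :=
  (hΦ.hasFDerivWithinAt (Q.edgeParam_mem i ht)).comp_hasDerivWithinAt t
    (Q.hasDerivWithinAt_edgeParam i t) fun _ => Q.edgeParam_mem i

theorem IsSmooth.derivWithin_edge (hΦ : Q.IsSmooth Φ) (i : Fin 4) {t : ℝ}
    (ht : t ∈ Icc (0 : ℝ) 1) : derivWithin (fun t => Φ (Q.edgeParam i t)) (Icc 0 1) t =
      Q.dirDeriv (edgeVec Q.vertex i) Φ (Q.edgeParam i t) :=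
  (hΦ.hasDerivWithinAt_edge i ht).derivWithin (uniqueDiffOn_unitInterval t ht)

theorem IsSmooth.derivWithin_dirDeriv_edge (hΦ : Q.IsSmooth Φ) {i j : Fin 4} (u : Plane) {t : ℝ}
    (ht : t ∈ Icc (0 : ℝ) 1) (hij : Q.edgeParam i t = Q.vertex j) :
    derivWithin (fun t => Q.dirDeriv u Φ (Q.edgeParam i t)) (Icc 0 1) t =
      Q.hess Φ (Q.vertex j) (edgeVec Q.vertex i) u := by
  have h := (hΦ.differentiableWithinAt_fderivWithin j).hasFDerivWithinAt
  rw [← hij] at h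
  have h' := (h.comp_hasDerivWithinAt t (Q.hasDerivWithinAt_edgeParam i t)
    fun _ => Q.edgeParam_mem i).clm_apply (hasDerivWithinAt_const t (Icc (0 : ℝ) 1) u)
  have := h'.derivWithin (uniqueDiffOn_unitInterval t ht)
  simp only [map_zero, add_zero, hij] at this
  exact this

theorem IsSmooth.iteratedDerivWithin_two_edge (hΦ : Q.IsSmooth Φ) {i j : Fin 4} {t : ℝ}
    (ht : t ∈ Icc (0 : ℝ) 1) (hij : Q.edgeParam i t = Q.vertex j) :
    iteratedDerivWithin 2 (fun t => Φ (Q.edgeParam i t)) (Icc 0 1) t =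
      Q.hess Φ (Q.vertex j) (edgeVec Q.vertex i) (edgeVec Q.vertex i) := by
  rw [← hΦ.derivWithin_dirDeriv_edge _ ht hij, iteratedDerivWithin_succ]
  refine derivWithin_congr (fun x hx => ?_) ?_
  · rw [iteratedDerivWithin_one, hΦ.derivWithin_edge i hx]
  · rw [iteratedDerivWithin_one, hΦ.derivWithin_edge i ht]

theorem IsSmooth.hasDerivWithinAt_fst (hΦ : Q.IsSmooth Φ) {x y : ℝ} (hx : x ∈ Icc (0 : ℝ) 1)
    (hy : y ∈ Icc (0 : ℝ) 1) : HasDerivWithinAt (fun x => Φ (Q.param (x, y)))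
      (Q.dirDeriv (Q.tangentFst y) Φ (Q.param (x, y))) (Icc 0 1) x := by
  have h1 : HasDerivWithinAt (fun x : ℝ => (x, y)) (1, 0) (Icc 0 1) x :=
    (hasDerivWithinAt_id x _).prodMk (hasDerivWithinAt_const x _ y)
  have h2 := (Q.hasFDerivAt_param (x, y)).comp_hasDerivWithinAt x h1
  have h3 := (hΦ.hasFDerivWithinAt (Q.mapsTo_param (x := (x, y)) ⟨hx, hy⟩)).comp_hasDerivWithinAt x
    h2 fun z hz => Q.mapsTo_param (x := (z, y)) ⟨hz, hy⟩
  rw [show Q.paramDeriv (x, y) (1, 0) = Q.tangentFst y by simp [paramDeriv_apply]] at h3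
  exact h3

theorem IsSmooth.hasDerivWithinAt_snd (hΦ : Q.IsSmooth Φ) {x y : ℝ} (hx : x ∈ Icc (0 : ℝ) 1)
    (hy : y ∈ Icc (0 : ℝ) 1) : HasDerivWithinAt (fun y => Φ (Q.param (x, y)))
      (Q.dirDeriv (Q.tangentSnd x) Φ (Q.param (x, y))) (Icc 0 1) y := by
  have h1 : HasDerivWithinAt (fun y : ℝ => (x, y)) (0, 1) (Icc 0 1) y :=
    (hasDerivWithinAt_const y _ x).prodMk (hasDerivWithinAt_id y _)
  have h2 := (Q.hasFDerivAt_param (x, y)).comp_hasDerivWithinAt y h1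
  have h3 := (hΦ.hasFDerivWithinAt (Q.mapsTo_param (x := (x, y)) ⟨hx, hy⟩)).comp_hasDerivWithinAt y
    h2 fun z hz => Q.mapsTo_param (x := (x, z)) ⟨hx, hz⟩
  rw [show Q.paramDeriv (x, y) (0, 1) = Q.tangentSnd x by simp [paramDeriv_apply]] at h3
  exact h3

/-- `crossVec` points inwards, which gives the signs on edges `1` and `2`; edges `2` and `3` run
against the coordinate direction, hence the argument `1 - t`. -/
theorem crossVec_zero_eq (t : ℝ) : Q.crossVec 0 t = Q.tangentSnd t := rfl

theorem crossVec_one_eq (t : ℝ) : Q.crossVec 1 t = - Q.tangentFst t := by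
  ext i
  simp [crossVec, tangentFst]
  ring

theorem crossVec_two_eq (t : ℝ) : Q.crossVec 2 t = - Q.tangentSnd (1 - t) := by
  ext i
  simp [crossVec, tangentSnd]
  ring

theorem crossVec_three_eq (t : ℝ) : Q.crossVec 3 t = Q.tangentFst (1 - t) := by
  ext i
  simp [crossVec, tangentFst]
  ring

theorem dirDeriv_neg (u z : Plane) : Q.dirDeriv (-u) Φ z = - Q.dirDeriv u Φ z := map_neg _ _

/-- The end point functionals of the slices in the second parameter. -/
theorem IsSmooth.nodal_snd (hΦ : Q.IsSmooth Φ) (p k : ℕ) {s : ℝ × ℝ → ℝ}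
    (hs : ∀ ξ ∈ unitSquare, Φ (Q.param ξ) = s ξ) {x : ℝ} (hx : x ∈ Icc (0 : ℝ) 1) (b : Fin 4) :
    nodal p k (fun y => s (x, y)) (.inl b) = ![Φ (Q.edgeParam 0 x), Φ (Q.edgeParam 2 (1 - x)),
      Q.dirDeriv (Q.crossVec 0 x) Φ (Q.edgeParam 0 x),
      - Q.dirDeriv (Q.crossVec 2 (1 - x)) Φ (Q.edgeParam 2 (1 - x))] b := by
  have h0 : (0 : ℝ) ∈ Icc (0 : ℝ) 1 := ⟨le_rfl, zero_le_one⟩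
  have h1 : (1 : ℝ) ∈ Icc (0 : ℝ) 1 := ⟨zero_le_one, le_rfl⟩
  have hd : ∀ y ∈ Icc (0 : ℝ) 1, derivWithin (fun y => s (x, y)) (Icc 0 1) y =
      Q.dirDeriv (Q.tangentSnd x) Φ (Q.param (x, y)) := fun y hy =>
    ((hΦ.hasDerivWithinAt_snd hx hy).congr (fun z hz => (hs (x, z) ⟨hx, hz⟩).symm)
      (hs (x, y) ⟨hx, hy⟩).symm).derivWithin (uniqueDiffOn_unitInterval y hy)
  fin_cases b
  · simp [nodal, edgeParam, refEdge, hs (x, 0) ⟨hx, h0⟩]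
  · simp [nodal, edgeParam, refEdge, hs (x, 1) ⟨hx, h1⟩]
  · simp [nodal, edgeParam, refEdge, hd 0 h0, crossVec_zero_eq]
  · simp [nodal, edgeParam, refEdge, hd 1 h1, crossVec_two_eq, dirDeriv_neg]

/-- The end point functionals of the slices in the first parameter. -/
theorem IsSmooth.nodal_fst (hΦ : Q.IsSmooth Φ) (p k : ℕ) {s : ℝ × ℝ → ℝ}
    (hs : ∀ ξ ∈ unitSquare, Φ (Q.param ξ) = s ξ) {y : ℝ} (hy : y ∈ Icc (0 : ℝ) 1) (a : Fin 4) :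
    nodal p k (fun x => s (x, y)) (.inl a) = ![Φ (Q.edgeParam 3 (1 - y)), Φ (Q.edgeParam 1 y),
      Q.dirDeriv (Q.crossVec 3 (1 - y)) Φ (Q.edgeParam 3 (1 - y)),
      - Q.dirDeriv (Q.crossVec 1 y) Φ (Q.edgeParam 1 y)] a := by
  have h0 : (0 : ℝ) ∈ Icc (0 : ℝ) 1 := ⟨le_rfl, zero_le_one⟩
  have h1 : (1 : ℝ) ∈ Icc (0 : ℝ) 1 := ⟨zero_le_one, le_rfl⟩
  have hd : ∀ x ∈ Icc (0 : ℝ) 1, derivWithin (fun x => s (x, y)) (Icc 0 1) x =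
      Q.dirDeriv (Q.tangentFst y) Φ (Q.param (x, y)) := fun x hx =>
    ((hΦ.hasDerivWithinAt_fst hx hy).congr (fun z hz => (hs (z, y) ⟨hz, hy⟩).symm)
      (hs (x, y) ⟨hx, hy⟩).symm).derivWithin (uniqueDiffOn_unitInterval x hx)
  fin_cases a
  · simp [nodal, edgeParam, refEdge, hs (0, y) ⟨h0, hy⟩]
  · simp [nodal, edgeParam, refEdge, hs (1, y) ⟨h1, hy⟩]
  · simp [nodal, edgeParam, refEdge, hd 0 h0, crossVec_three_eq]
  · simp [nodal, edgeParam, refEdge, hd 1 h1, crossVec_one_eq, dirDeriv_neg]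

/-- The derivative across an edge in terms of the normal and the tangential derivative. -/
theorem det₂_mul_dirDeriv (i : Fin 4) (u c z : Plane) :
    det₂ (edgeVec Q.vertex i) u * Q.dirDeriv c Φ z =
      det₂ c u * Q.dirDeriv (edgeVec Q.vertex i) Φ z +
        det₂ (edgeVec Q.vertex i) c * Q.dirDeriv u Φ z := by
  have := congrArg (fderivWithin ℝ Φ Q.closedSet z) (det₂_smul_eq (edgeVec Q.vertex i) u c)
  simpa [dirDeriv] using this

/-- An edge both orthogonal and parallel to its unit normal would vanish, against convexity. So edge
and normal form a basis for Cramer's rule. -/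
theorem IsUnitNormals.det₂_ne_zero {n : Fin 4 → Plane} (hn : Q.IsUnitNormals n) (i : Fin 4) :
    det₂ (edgeVec Q.vertex i) (n i) ≠ 0 := by
  intro h
  obtain ⟨h1, h2⟩ := hn i
  have h3 : (n i 0) ^ 2 + (n i 1) ^ 2 = 1 := by
    have := EuclideanSpace.norm_sq_eq (n i)
    rw [h1] at this
    simpa [Fin.sum_univ_two] using this.symm
  have h4 : n i 0 * edgeVec Q.vertex i 0 + n i 1 * edgeVec Q.vertex i 1 = 0 := by
    have := h2
    simp [PiLp.inner_apply, Fin.sum_univ_two] at this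
    linarith
  have h5 := Q.det₂_edge_crossVec_zero i
  simp only [det₂] at h h5
  have e0 : edgeVec Q.vertex i 0 = 0 := by
    linear_combination (-(edgeVec Q.vertex i 0)) * h3 + n i 0 * h4 + n i 1 * h
  have e1 : edgeVec Q.vertex i 1 = 0 := by
    linear_combination (-(edgeVec Q.vertex i 1)) * h3 + n i 1 * h4 - n i 0 * h
  simp [e0, e1] at h5

end Quadrilateral

end SplineElement

namespace SplineElement

open Set

/-! ### Two-jets at the vertices -/

/-- The linear part of a two-jet. -/
noncomputable def jetLin (J : Fin 6 → ℝ) (u : Plane) : ℝ := J 1 * u 0 + J 2 * u 1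

/-- The quadratic part of a two-jet. -/
noncomputable def jetQuad (J : Fin 6 → ℝ) (u w : Plane) : ℝ :=
  J 3 * (u 0 * w 0) + J 4 * (u 0 * w 1 + u 1 * w 0) + J 5 * (u 1 * w 1)

theorem det₂_mul_jetLin (J : Fin 6 → ℝ) (e u c : Plane) :
    det₂ e u * jetLin J c = det₂ c u * jetLin J e + det₂ e c * jetLin J u := by
  simp only [det₂, jetLin]; ring

theorem det₂_mul_jetQuad (J : Fin 6 → ℝ) (e u c : Plane) :
    det₂ e u * jetQuad J e c = det₂ c u * jetQuad J e e + det₂ e c * jetQuad J e u := by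
  simp only [det₂, jetQuad]; ring

/-- A two-jet is determined by its value, two directional derivatives, and three suitable second
derivatives. -/
theorem jet_ext {J K : Fin 6 → ℝ} {e e' u : Plane} (hu : det₂ e u ≠ 0) (he : det₂ e' e ≠ 0)
    (h0 : J 0 = K 0) (h1 : jetLin J e = jetLin K e) (h1' : jetLin J e' = jetLin K e')
    (h2 : jetQuad J e e = jetQuad K e e) (h2' : jetQuad J e' e' = jetQuad K e' e')
    (h3 : jetQuad J e u = jetQuad K e u) : J = K := by
  simp only [det₂, jetLin, jetQuad] at *
  -- The difference of the quadratic parts, as a symmetric matrix, maps `e` to a vector that pairs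
  -- to zero with the basis `e`, `u`. Hence it annihilates `e`, and the value on `e'` then
  -- determines it.
  have hw0 : (J 3 - K 3) * e 0 + (J 4 - K 4) * e 1 = 0 := by
    refine (mul_eq_zero.1 ?_).resolve_left hu
    linear_combination u 1 * h2 - e 1 * h3
  have hw1 : (J 4 - K 4) * e 0 + (J 5 - K 5) * e 1 = 0 := by
    refine (mul_eq_zero.1 ?_).resolve_left hu
    linear_combination e 0 * h3 - u 0 * h2
  have hsq := pow_ne_zero 2 he
  have e1 : J 1 = K 1 := by
    refine sub_eq_zero.1 ((mul_eq_zero.1 ?_).resolve_left he)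
    linear_combination e 1 * h1' - e' 1 * h1
  have e2 : J 2 = K 2 := by
    refine sub_eq_zero.1 ((mul_eq_zero.1 ?_).resolve_left he)
    linear_combination e' 0 * h1 - e 0 * h1'
  have e3 : J 3 = K 3 := by
    refine sub_eq_zero.1 ((mul_eq_zero.1 ?_).resolve_left hsq)
    linear_combination e 1 ^ 2 * h2' + (e' 1 ^ 2 * e 0 - 2 * e 1 * e' 0 * e' 1) * hw0 -
      e' 1 ^ 2 * e 1 * hw1
  have e4 : J 4 = K 4 := by
    refine sub_eq_zero.1 ((mul_eq_zero.1 ?_).resolve_left hsq)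
    linear_combination -(e 0 * e 1) * h2' + e' 0 ^ 2 * e 1 * hw0 + e' 1 ^ 2 * e 0 * hw1
  have e5 : J 5 = K 5 := by
    refine sub_eq_zero.1 ((mul_eq_zero.1 ?_).resolve_left hsq)
    linear_combination e 0 ^ 2 * h2' + (e' 0 ^ 2 * e 1 - 2 * e 0 * e' 0 * e' 1) * hw1 -
      e' 0 ^ 2 * e 0 * hw0
  funext m
  fin_cases m <;> assumption

/-! ### Further operations on splines -/

theorem differentiableOn_of_mem {d r k : ℕ} (hr : 1 ≤ r) {f : ℝ → ℝ} (hf : f ∈ splineSpace d r k) :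
    DifferentiableOn ℝ f (Icc 0 1) :=
  hf.1.differentiableOn (by exact_mod_cast (by omega : r ≠ 0))

theorem reflect_mem {t : ℝ} (ht : t ∈ Icc (0 : ℝ) 1) : 1 - t ∈ Icc (0 : ℝ) 1 :=
  ⟨by linarith [ht.2], by linarith [ht.1]⟩

theorem reflect_mem_splineSpace {d r k : ℕ} {f : ℝ → ℝ} (hf : f ∈ splineSpace d r k) :
    (fun t => f (1 - t)) ∈ splineSpace d r k := by
  refine ⟨hf.1.comp (by fun_prop : ContDiff ℝ r fun t : ℝ => 1 - t).contDiffOn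
    fun t => reflect_mem, fun j hj => ?_⟩
  have hk : (0 : ℝ) < k := by exact_mod_cast (by omega : 0 < k)
  obtain ⟨P, hP, h⟩ := hf.2 (k - 1 - j) (by omega)
  refine ⟨P.comp (1 - Polynomial.X), ?_, fun x hx => ?_⟩
  · refine Polynomial.natDegree_comp_le.trans ?_
    have : (1 - Polynomial.X : Polynomial ℝ).natDegree ≤ 1 := by compute_degree
    nlinarith
  · have hc : ((k - 1 - j : ℕ) : ℝ) = k - 1 - j := by
      rw [Nat.cast_sub (by omega), Nat.cast_sub (by omega)]; simp
    have h1 := hx.1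
    have h2 := hx.2
    rw [div_le_iff₀ hk] at h1
    rw [le_div_iff₀ hk] at h2
    have := h (1 - x) ⟨by rw [hc, div_le_iff₀ hk]; linarith, by rw [hc, le_div_iff₀ hk]; linarith⟩
    simpa using this

theorem derivWithin_reflect {f : ℝ → ℝ} (hf : DifferentiableOn ℝ f (Icc 0 1)) {t : ℝ}
    (ht : t ∈ Icc (0 : ℝ) 1) :
    derivWithin (fun t => f (1 - t)) (Icc 0 1) t = - derivWithin f (Icc 0 1) (1 - t) := by
  have h1 := (hf (1 - t) (reflect_mem ht)).hasDerivWithinAt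
  have h2 := h1.scomp t ((hasDerivWithinAt_id t (Icc (0 : ℝ) 1)).const_sub 1) fun t => reflect_mem
  simpa [Function.comp_def] using h2.derivWithin (uniqueDiffOn_unitInterval t ht)

/-! ### Jets at the vertices, cross derivatives and edge data -/

namespace Quadrilateral

variable {Q : Quadrilateral}

/-- The two-jet of a function at a vertex, in terms of partial derivatives. -/
noncomputable def jet (Q : Quadrilateral) (Φ : Plane → ℝ) (z : Plane) : Fin 6 → ℝ :=
  ![Φ z, Q.partialDeriv 0 Φ z, Q.partialDeriv 1 Φ z,
    Q.partialDeriv 0 (Q.partialDeriv 0 Φ) z, Q.partialDeriv 0 (Q.partialDeriv 1 Φ) z,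
    Q.partialDeriv 1 (Q.partialDeriv 1 Φ) z]

theorem plane_eq (u : Plane) : u = u 0 • EuclideanSpace.single 0 (1 : ℝ) +
    u 1 • EuclideanSpace.single 1 (1 : ℝ) := by
  ext i
  fin_cases i <;> simp

theorem dirDeriv_eq_jetLin (Φ : Plane → ℝ) (z u : Plane) :
    Q.dirDeriv u Φ z = jetLin (Q.jet Φ z) u := by
  have := congrArg (fderivWithin ℝ Φ Q.closedSet z) (plane_eq u)
  rw [map_add, map_smul, map_smul] at this
  simp only [dirDeriv, jetLin, jet, partialDeriv] at this ⊢
  rw [this]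
  simp [mul_comm]

theorem IsSmooth.hess_eq_jetQuad {Φ : Plane → ℝ} (hΦ : Q.IsSmooth Φ) (i : Fin 4) (u w : Plane) :
    Q.hess Φ (Q.vertex i) u w = jetQuad (Q.jet Φ (Q.vertex i)) u w := by
  have hs := hΦ.hess_symm i (EuclideanSpace.single 1 1) (EuclideanSpace.single 0 1)
  have e : Q.hess Φ (Q.vertex i) u w = Q.hess Φ (Q.vertex i)
      (u 0 • EuclideanSpace.single 0 (1 : ℝ) + u 1 • EuclideanSpace.single 1 (1 : ℝ))
      (w 0 • EuclideanSpace.single 0 (1 : ℝ) + w 1 • EuclideanSpace.single 1 (1 : ℝ)) := by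
    rw [← plane_eq, ← plane_eq]
  rw [e]
  simp only [jetQuad, jet, hΦ.partialDeriv_partialDeriv, map_add, map_smul,
    add_apply, smul_apply, smul_eq_mul, hs, Matrix.cons_val]
  ring

variable {n : Fin 4 → Plane}

/-- The derivative across the `i`-th edge, computed from the trace `f` and the normal
derivative `g`. -/
noncomputable def crossFun (Q : Quadrilateral) (n : Fin 4 → Plane) (i : Fin 4) (f g : ℝ → ℝ)
    (t : ℝ) : ℝ :=
  (det₂ (Q.crossVec i t) (n i) * derivWithin f (Icc 0 1) t +
    det₂ (edgeVec Q.vertex i) (Q.crossVec i t) * g t) / det₂ (edgeVec Q.vertex i) (n i)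

theorem det₂_crossVec_left (i : Fin 4) (u : Plane) (t : ℝ) : det₂ (Q.crossVec i t) u =
    det₂ (Q.crossVec i 0) u + (det₂ (Q.crossVec i 1) u - det₂ (Q.crossVec i 0) u) * t := by
  rw [crossVec_eq, det₂_smul_add_left]; ring

theorem det₂_crossVec_right (i : Fin 4) (u : Plane) (t : ℝ) : det₂ u (Q.crossVec i t) =
    det₂ u (Q.crossVec i 0) + (det₂ u (Q.crossVec i 1) - det₂ u (Q.crossVec i 0)) * t := by
  rw [crossVec_eq, det₂_smul_add_right]; ring

/-- Both the derivative of `f` and `g` have degree `p - 1` and regularity `p - 2`; the affine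
coefficients raise the degree to `p`. -/
theorem crossFun_mem {p k : ℕ} (hp : 3 ≤ p) (hk : 0 < k) (i : Fin 4) {f g : ℝ → ℝ}
    (hf : f ∈ splineSpace p (p - 1) k) (hg : g ∈ splineSpace (p - 1) (p - 2) k) :
    Q.crossFun n i f g ∈ splineSpace p (p - 2) k := by
  have hf' : (fun x => derivWithin f (Icc 0 1) x) ∈ splineSpace (p - 1) (p - 2) k :=
    derivWithin_mem_splineSpace hk (splineSpace_mono le_rfl (by omega) hf)
  have h1 := affine_mul_mem_splineSpace hf' (det₂ (Q.crossVec i 0) (n i))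
    (det₂ (Q.crossVec i 1) (n i) - det₂ (Q.crossVec i 0) (n i))
  have h2 := affine_mul_mem_splineSpace hg (det₂ (edgeVec Q.vertex i) (Q.crossVec i 0))
    (det₂ (edgeVec Q.vertex i) (Q.crossVec i 1) - det₂ (edgeVec Q.vertex i) (Q.crossVec i 0))
  refine splineSpace_mono (d := p - 1 + 1) (by omega) le_rfl (splineSpace_congr
    ((splineSpace _ _ _).smul_mem (det₂ (edgeVec Q.vertex i) (n i))⁻¹
      ((splineSpace _ _ _).add_mem h1 h2)) fun x _ => ?_)
  simp only [crossFun, Pi.smul_apply, Pi.add_apply, smul_eq_mul]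
  rw [det₂_crossVec_left i (n i) x, det₂_crossVec_right i _ x, div_eq_inv_mul]

theorem crossFun_eq (hn : Q.IsUnitNormals n) (i : Fin 4) {f g : ℝ → ℝ} {t : ℝ} {J : Fin 6 → ℝ}
    (h1 : derivWithin f (Icc 0 1) t = jetLin J (edgeVec Q.vertex i)) (h2 : g t = jetLin J (n i)) :
    Q.crossFun n i f g t = jetLin J (Q.crossVec i t) := by
  rw [crossFun, div_eq_iff (hn.det₂_ne_zero i), h1, h2, ← det₂_mul_jetLin, mul_comm]

/-- The linear term arises because the cross direction varies along the edge; its argument is, up to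
sign, the mixed second derivative of `param`. -/
theorem derivWithin_crossFun {p k : ℕ} (hp : 3 ≤ p) (hk : 0 < k) (hn : Q.IsUnitNormals n)
    (i : Fin 4) {f g : ℝ → ℝ} (hf : f ∈ splineSpace p (p - 1) k)
    (hg : g ∈ splineSpace (p - 1) (p - 2) k) {t : ℝ} (ht : t ∈ Icc (0 : ℝ) 1) {J : Fin 6 → ℝ}
    (h1 : derivWithin f (Icc 0 1) t = jetLin J (edgeVec Q.vertex i)) (h2 : g t = jetLin J (n i))
    (h3 : iteratedDerivWithin 2 f (Icc 0 1) t =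
      jetQuad J (edgeVec Q.vertex i) (edgeVec Q.vertex i))
    (h4 : derivWithin g (Icc 0 1) t = jetQuad J (edgeVec Q.vertex i) (n i)) :
    derivWithin (Q.crossFun n i f g) (Icc 0 1) t =
      jetQuad J (edgeVec Q.vertex i) (Q.crossVec i t) +
        jetLin J (Q.crossVec i 1 - Q.crossVec i 0) := by
  have hf' : (fun x => derivWithin f (Icc 0 1) x) ∈ splineSpace (p - 1) (p - 2) k :=
    derivWithin_mem_splineSpace hk (splineSpace_mono le_rfl (by omega) hf)
  have d1 := (differentiableOn_of_mem (by omega) hf' t ht).hasDerivWithinAt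
  have d2 := (differentiableOn_of_mem (by omega) hg t ht).hasDerivWithinAt
  have e1 : derivWithin (fun x => derivWithin f (Icc 0 1) x) (Icc 0 1) t =
      jetQuad J (edgeVec Q.vertex i) (edgeVec Q.vertex i) := by
    rw [← h3, iteratedDerivWithin_succ, iteratedDerivWithin_one]
  have a1 : HasDerivWithinAt (fun t => det₂ (Q.crossVec i t) (n i))
      (det₂ (Q.crossVec i 1) (n i) - det₂ (Q.crossVec i 0) (n i)) (Icc 0 1) t := by
    refine HasDerivWithinAt.congr ?_ (fun x _ => det₂_crossVec_left i (n i) x)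
      (det₂_crossVec_left i (n i) t)
    simpa using ((hasDerivWithinAt_id t (Icc (0 : ℝ) 1)).const_mul
      (det₂ (Q.crossVec i 1) (n i) - det₂ (Q.crossVec i 0) (n i))).const_add
        (det₂ (Q.crossVec i 0) (n i))
  have a2 : HasDerivWithinAt (fun t => det₂ (edgeVec Q.vertex i) (Q.crossVec i t))
      (det₂ (edgeVec Q.vertex i) (Q.crossVec i 1) - det₂ (edgeVec Q.vertex i) (Q.crossVec i 0))
      (Icc 0 1) t := by
    refine HasDerivWithinAt.congr ?_ (fun x _ => det₂_crossVec_right i (edgeVec Q.vertex i) x)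
      (det₂_crossVec_right i (edgeVec Q.vertex i) t)
    simpa using ((hasDerivWithinAt_id t (Icc (0 : ℝ) 1)).const_mul
      (det₂ (edgeVec Q.vertex i) (Q.crossVec i 1) -
        det₂ (edgeVec Q.vertex i) (Q.crossVec i 0))).const_add
          (det₂ (edgeVec Q.vertex i) (Q.crossVec i 0))
  have h := ((a1.fun_mul d1).fun_add (a2.fun_mul d2)).div_const (det₂ (edgeVec Q.vertex i) (n i))
  refine (h.derivWithin (uniqueDiffOn_unitInterval t ht)).trans ?_
  rw [e1, h1, h2, h4, div_eq_iff (hn.det₂_ne_zero i)]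
  have k1 := det₂_mul_jetQuad J (edgeVec Q.vertex i) (n i) (Q.crossVec i t)
  have k2 := det₂_mul_jetLin J (edgeVec Q.vertex i) (n i) (Q.crossVec i 1 - Q.crossVec i 0)
  have k3 : det₂ (Q.crossVec i 1 - Q.crossVec i 0) (n i) =
      det₂ (Q.crossVec i 1) (n i) - det₂ (Q.crossVec i 0) (n i) := by simp [det₂]; ring
  have k4 : det₂ (edgeVec Q.vertex i) (Q.crossVec i 1 - Q.crossVec i 0) =
      det₂ (edgeVec Q.vertex i) (Q.crossVec i 1) -
        det₂ (edgeVec Q.vertex i) (Q.crossVec i 0) := by simp [det₂]; ring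
  rw [k3, k4] at k2
  linear_combination -k1 - k2

/-- The traces and normal derivatives on the edges match a family of two-jets at the vertices. -/
structure EdgeData (Q : Quadrilateral) (n : Fin 4 → Plane) (p k : ℕ) (J : Fin 4 → Fin 6 → ℝ)
    (f g : Fin 4 → ℝ → ℝ) : Prop where
  trace_mem : ∀ i, f i ∈ splineSpace p (p - 1) k
  normal_mem : ∀ i, g i ∈ splineSpace (p - 1) (p - 2) k
  trace_zero : ∀ i, f i 0 = J i 0
  trace_one : ∀ i, f i 1 = J (i + 1) 0
  deriv_trace_zero : ∀ i, derivWithin (f i) (Icc 0 1) 0 = jetLin (J i) (edgeVec Q.vertex i)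
  deriv_trace_one : ∀ i, derivWithin (f i) (Icc 0 1) 1 = jetLin (J (i + 1)) (edgeVec Q.vertex i)
  deriv2_trace_zero : ∀ i, iteratedDerivWithin 2 (f i) (Icc 0 1) 0 =
    jetQuad (J i) (edgeVec Q.vertex i) (edgeVec Q.vertex i)
  deriv2_trace_one : ∀ i, iteratedDerivWithin 2 (f i) (Icc 0 1) 1 =
    jetQuad (J (i + 1)) (edgeVec Q.vertex i) (edgeVec Q.vertex i)
  normal_zero : ∀ i, g i 0 = jetLin (J i) (n i)
  normal_one : ∀ i, g i 1 = jetLin (J (i + 1)) (n i)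
  deriv_normal_zero : ∀ i, derivWithin (g i) (Icc 0 1) 0 = jetQuad (J i) (edgeVec Q.vertex i) (n i)
  deriv_normal_one : ∀ i, derivWithin (g i) (Icc 0 1) 1 =
    jetQuad (J (i + 1)) (edgeVec Q.vertex i) (n i)

/-- Three Hermite data per end leave `k + p - 6` values for a trace; two leave `k + p - 5` for a
normal derivative. The bound `hpk` keeps these differences from being truncated. -/
theorem exists_edgeData (Q : Quadrilateral) (n : Fin 4 → Plane) {p k : ℕ} (hp : 3 ≤ p) (hk : 0 < k)
    (hpk : 6 ≤ p + k) (J : Fin 4 → Fin 6 → ℝ) (a : Fin 4 → Fin (k + p - 6) → ℝ)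
    (b : Fin 4 → Fin (k + p - 5) → ℝ) : ∃ f g, EdgeData Q n p k J f g ∧
      (∀ i (j : Fin (k + p - 6)), f i (eta p k (j + 3)) = a i j) ∧
      ∀ i (j : Fin (k + p - 5)), g i (eta (p - 1) k (j + 2)) = b i j := by
  have hf := fun i => exists_spline (d := p) (r := p - 1) (μ := 1) (m := 3) (n := k + p - 6)
    hk le_rfl (by omega) (by omega) (by omega) (by omega) (by omega)
    ![J i 0, jetLin (J i) (edgeVec Q.vertex i),
      jetQuad (J i) (edgeVec Q.vertex i) (edgeVec Q.vertex i)]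
    ![J (i + 1) 0, jetLin (J (i + 1)) (edgeVec Q.vertex i),
      jetQuad (J (i + 1)) (edgeVec Q.vertex i) (edgeVec Q.vertex i)] (a i)
  have hg := fun i => exists_spline (d := p - 1) (r := p - 2) (μ := 1) (m := 2) (n := k + p - 5)
    hk le_rfl (by omega) (by omega) (by omega) (by omega) (by omega)
    ![jetLin (J i) (n i), jetQuad (J i) (edgeVec Q.vertex i) (n i)]
    ![jetLin (J (i + 1)) (n i), jetQuad (J (i + 1)) (edgeVec Q.vertex i) (n i)] (b i)
  choose f hf hf0 hf1 hfa using hf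
  choose g hg hg0 hg1 hgb using hg
  refine ⟨f, g, ⟨hf, hg, fun i => ?_, fun i => ?_, fun i => ?_, fun i => ?_, fun i => ?_,
    fun i => ?_, fun i => ?_, fun i => ?_, fun i => ?_, fun i => ?_⟩, hfa, hgb⟩
  · simpa using hf0 i 0
  · simpa using hf1 i 0
  · simpa [iteratedDerivWithin_one] using hf0 i 1
  · simpa [iteratedDerivWithin_one] using hf1 i 1
  · simpa using hf0 i 2
  · simpa using hf1 i 2
  · simpa using hg0 i 0
  · simpa using hg1 i 0
  · simpa [iteratedDerivWithin_one] using hg0 i 1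
  · simpa [iteratedDerivWithin_one] using hg1 i 1

/-! ### Compatibility of edge data at the corners -/

section

variable {p k : ℕ} {J : Fin 4 → Fin 6 → ℝ} {f g : Fin 4 → ℝ → ℝ}

theorem jetLin_neg (J : Fin 6 → ℝ) (u : Plane) : jetLin J (-u) = - jetLin J u := by
  simp [jetLin]; ring

/-- Compatibility at the vertex between the `i`-th edge and the next one. -/
theorem EdgeData.corner (h : EdgeData Q n p k J f g) (hp : 3 ≤ p) (hk : 0 < k)
    (hn : Q.IsUnitNormals n) (i : Fin 4) :
    f i 1 = f (i + 1) 0 ∧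
    derivWithin (f i) (Icc 0 1) 1 = - Q.crossFun n (i + 1) (f (i + 1)) (g (i + 1)) 0 ∧
    Q.crossFun n i (f i) (g i) 1 = derivWithin (f (i + 1)) (Icc 0 1) 0 ∧
    derivWithin (Q.crossFun n i (f i) (g i)) (Icc 0 1) 1 =
      - derivWithin (Q.crossFun n (i + 1) (f (i + 1)) (g (i + 1))) (Icc 0 1) 0 := by
  have h0 : (0 : ℝ) ∈ Icc (0 : ℝ) 1 := ⟨le_rfl, zero_le_one⟩
  have h1 : (1 : ℝ) ∈ Icc (0 : ℝ) 1 := ⟨zero_le_one, le_rfl⟩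
  refine ⟨?_, ?_, ?_, ?_⟩
  · rw [h.trace_one, h.trace_zero]
  · rw [h.deriv_trace_one, crossFun_eq hn _ (h.deriv_trace_zero _) (h.normal_zero _),
      crossVec_zero, add_sub_cancel_right, jetLin_neg, neg_neg]
  · rw [h.deriv_trace_zero, crossFun_eq hn _ (h.deriv_trace_one _) (h.normal_one _),
      crossVec_one]
  · rw [derivWithin_crossFun hp hk hn i (h.trace_mem i) (h.normal_mem i) h1 (h.deriv_trace_one i)
        (h.normal_one i) (h.deriv2_trace_one i) (h.deriv_normal_one i),
      derivWithin_crossFun hp hk hn (i + 1) (h.trace_mem _) (h.normal_mem _) h0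
        (h.deriv_trace_zero _) (h.normal_zero _) (h.deriv2_trace_zero _) (h.deriv_normal_zero _)]
    have e3 : i + 3 = i - 1 := by rw [sub_eq_add_neg]; rfl
    have e4 : i + 1 + 2 = i - 1 := by rw [← e3, add_assoc]; rfl
    -- The quadratic parts cancel by symmetry of `jetQuad`, and the variations of `crossVec` along
    -- the two edges are opposite vectors.
    simp only [crossVec, add_sub_cancel_right, fin_four_add_one_add_one, e4, edgeVec, jetQuad,
      jetLin, PiLp.sub_apply, PiLp.add_apply, PiLp.smul_apply, smul_eq_mul]
    ring

/-- The tensor-product spline with given edge data. -/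
theorem EdgeData.exists_tensor (h : EdgeData Q n p k J f g) (hp : 3 ≤ p) (hk : 0 < k)
    (hpk : 5 ≤ 2 * k + p) (hn : Q.IsUnitNormals n)
    (c : Fin (2 * k + p - 5) → Fin (2 * k + p - 5) → ℝ) :
    ∃ s ∈ tensorSplineSpace p (p - 2) k,
      (∀ x ∈ Icc (0 : ℝ) 1, ∀ b, nodal p k (fun y => s (x, y)) (.inl b) =
        ![f 0 x, f 2 (1 - x), Q.crossFun n 0 (f 0) (g 0) x,
          - Q.crossFun n 2 (f 2) (g 2) (1 - x)] b) ∧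
      (∀ y ∈ Icc (0 : ℝ) 1, ∀ a, nodal p k (fun x => s (x, y)) (.inl a) =
        ![f 3 (1 - y), f 1 y, Q.crossFun n 3 (f 3) (g 3) (1 - y),
          - Q.crossFun n 1 (f 1) (g 1) y] a) ∧
      ∀ i j : Fin (2 * k + p - 5), s (theta p k (i + 2), theta p k (j + 2)) = c i j := by
  have h0 : (0 : ℝ) ∈ Icc (0 : ℝ) 1 := ⟨le_rfl, zero_le_one⟩
  have h1 : (1 : ℝ) ∈ Icc (0 : ℝ) 1 := ⟨zero_le_one, le_rfl⟩
  obtain ⟨H, hH⟩ : ∃ H : Fin 4 → ℝ → ℝ, ∀ i, Q.crossFun n i (f i) (g i) = H i :=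
    ⟨_, fun _ => rfl⟩
  have hfS : ∀ i, f i ∈ splineSpace p (p - 2) k := fun i =>
    splineSpace_mono le_rfl (by omega) (h.trace_mem i)
  have hHS : ∀ i, H i ∈ splineSpace p (p - 2) k := fun i =>
    hH i ▸ crossFun_mem hp hk i (h.trace_mem i) (h.normal_mem i)
  have dr : ∀ {u : ℝ → ℝ}, u ∈ splineSpace p (p - 2) k → ∀ {t : ℝ}, t ∈ Icc (0 : ℝ) 1 →
      derivWithin (fun t => u (1 - t)) (Icc 0 1) t = - derivWithin u (Icc 0 1) (1 - t) :=
    fun hu _ ht => derivWithin_reflect (differentiableOn_of_mem (by omega) hu) ht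
  have c0 := h.corner hp hk hn 0
  have c1 := h.corner hp hk hn 1
  have c2 := h.corner hp hk hn 2
  have c3 := h.corner hp hk hn 3
  simp only [hH, zero_add, show (3 + 1 : Fin 4) = 0 from rfl, show (1 + 1 : Fin 4) = 2 from rfl,
    show (2 + 1 : Fin 4) = 3 from rfl] at c0 c1 c2 c3
  have hneg : ∀ (u : ℝ → ℝ) t, derivWithin (fun t => - u t) (Icc 0 1) t =
      - derivWithin u (Icc 0 1) t := fun u t => derivWithin.fun_neg
  obtain ⟨X, hX⟩ : ∃ X : Fin 4 → ℝ → ℝ,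
    -- Edge data rewritten in the coordinate directions: reflection for edges `2` and `3`, a sign
    -- for inward derivatives at coordinate `1`.
    X = ![f 0, fun t => f 2 (1 - t), H 0, fun t => - H 2 (1 - t)] := ⟨_, rfl⟩
  obtain ⟨Y, hY⟩ : ∃ Y : Fin 4 → ℝ → ℝ,
    Y = ![fun t => f 3 (1 - t), f 1, fun t => H 3 (1 - t), fun t => - H 1 t] := ⟨_, rfl⟩
  have hXS : ∀ b, X b ∈ splineSpace p (p - 2) k := by
    intro b
    rw [hX]
    fin_cases b
    · exact hfS 0
    · exact reflect_mem_splineSpace (hfS 2)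
    · exact hHS 0
    · exact (splineSpace _ _ _).neg_mem (reflect_mem_splineSpace (hHS 2))
  have hYS : ∀ a, Y a ∈ splineSpace p (p - 2) k := by
    intro a
    rw [hY]
    fin_cases a
    · exact reflect_mem_splineSpace (hfS 3)
    · exact hfS 1
    · exact reflect_mem_splineSpace (hHS 3)
    · exact (splineSpace _ _ _).neg_mem (hHS 1)
  -- Sixteen identities, four from each corner: value, two first derivatives, mixed derivative.
  have hXY : ∀ a b, nodal p k (X b) (.inl a) = nodal p k (Y a) (.inl b) := by
    intro a b
    rw [hX, hY]
    fin_cases a <;> fin_cases b <;>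
      simp [nodal, hneg, dr (hfS _) h0, dr (hfS _) h1, dr (hHS _) h0, dr (hHS _) h1, c0, c1, c2,
        c3]
  obtain ⟨s, hs, h2, h3, h4⟩ := SplineElement.exists_tensor hp hk hpk hXS hYS hXY c
  refine ⟨s, hs, fun x hx b => ?_, fun y hy a => ?_, h4⟩
  · rw [h2 x hx b, hH, hH, hX]
    fin_cases b <;> rfl
  · rw [h3 y hy a, hH, hH, hY]
    fin_cases a <;> rfl

end

end Quadrilateral

end SplineElement

namespace SplineElement

open Set

namespace Quadrilateral

variable {Q : Quadrilateral} {n : Fin 4 → Plane} {p k : ℕ}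

/-! ### The local space is a linear space with linear degrees of freedom -/

theorem ext_apply (φ : Q.closedSet → ℝ) {z : Plane} (hz : z ∈ Q.closedSet) :
    Q.ext φ z = φ ⟨z, hz⟩ :=
  Subtype.val_injective.extend_apply φ 0 (⟨z, hz⟩ : Q.closedSet)

theorem ext_of_notMem (φ : Q.closedSet → ℝ) {z : Plane} (hz : z ∉ Q.closedSet) :
    Q.ext φ z = 0 :=
  Function.extend_apply' _ _ _ (by rintro ⟨w, rfl⟩; exact hz w.2)

theorem ext_add (φ ψ : Q.closedSet → ℝ) : Q.ext (φ + ψ) = Q.ext φ + Q.ext ψ := by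
  funext z
  by_cases hz : z ∈ Q.closedSet
  · simp [ext_apply _ hz]
  · simp [ext_of_notMem _ hz]

theorem ext_smul (c : ℝ) (φ : Q.closedSet → ℝ) : Q.ext (c • φ) = c • Q.ext φ := by
  funext z
  by_cases hz : z ∈ Q.closedSet
  · simp [ext_apply _ hz]
  · simp [ext_of_notMem _ hz]

theorem ext_zero : Q.ext 0 = 0 := by
  simpa using ext_smul (Q := Q) 0 0

/-- Differentiability makes the derivatives below additive, hence the space and the functionals
linear. -/
theorem isSmooth_of_mem (hp : 3 ≤ p) (hk : 0 < k) {φ : Q.closedSet → ℝ}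
    (hφ : φ ∈ Q.localSpace n p k) : Q.IsSmooth (Q.ext φ) := by
  obtain ⟨⟨s, hs, h⟩, -⟩ := hφ
  exact Q.isSmooth_of_pullback hp hk hs h

theorem IsSmooth.dirDeriv_add {Φ Ψ : Plane → ℝ} (hΦ : Q.IsSmooth Φ) (hΨ : Q.IsSmooth Ψ) (u : Plane)
    {z : Plane} (hz : z ∈ Q.closedSet) :
    Q.dirDeriv u (Φ + Ψ) z = Q.dirDeriv u Φ z + Q.dirDeriv u Ψ z := by
  have := ((hΦ.hasFDerivWithinAt hz).add (hΨ.hasFDerivWithinAt hz)).fderivWithin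
    (Q.uniqueDiffOn_closedSet z hz)
  rw [dirDeriv, this]
  rfl

theorem IsSmooth.dirDeriv_smul {Φ : Plane → ℝ} (hΦ : Q.IsSmooth Φ) (c : ℝ) (u : Plane)
    {z : Plane} (hz : z ∈ Q.closedSet) : Q.dirDeriv u (c • Φ) z = c * Q.dirDeriv u Φ z := by
  have := ((hΦ.hasFDerivWithinAt hz).const_smul c).fderivWithin (Q.uniqueDiffOn_closedSet z hz)
  rw [dirDeriv, this]
  rfl

theorem IsSmooth.partialDeriv_partialDeriv_add {Φ Ψ : Plane → ℝ} (hΦ : Q.IsSmooth Φ)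
    (hΨ : Q.IsSmooth Ψ) (a b : Fin 2) (i : Fin 4) :
    Q.partialDeriv a (Q.partialDeriv b (Φ + Ψ)) (Q.vertex i) =
      Q.partialDeriv a (Q.partialDeriv b Φ) (Q.vertex i) +
        Q.partialDeriv a (Q.partialDeriv b Ψ) (Q.vertex i) := by
  have hv := Q.vertex_mem i
  have hadd : Q.IsSmooth (Φ + Ψ) := ⟨hΦ.1.add hΨ.1, fun i => (hΦ.2 i).add (hΨ.2 i)⟩
  have h := ((hΦ.differentiableWithinAt_fderivWithin i).hasFDerivWithinAt.add
    (hΨ.differentiableWithinAt_fderivWithin i).hasFDerivWithinAt).congr (fun z hz =>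
      ((hΦ.hasFDerivWithinAt hz).add (hΨ.hasFDerivWithinAt hz)).fderivWithin
        (Q.uniqueDiffOn_closedSet z hz))
      (((hΦ.hasFDerivWithinAt hv).add (hΨ.hasFDerivWithinAt hv)).fderivWithin
        (Q.uniqueDiffOn_closedSet _ hv))
  rw [hΦ.partialDeriv_partialDeriv, hΨ.partialDeriv_partialDeriv, hadd.partialDeriv_partialDeriv,
    hess, h.fderivWithin (Q.uniqueDiffOn_closedSet _ hv)]
  rfl

theorem IsSmooth.partialDeriv_partialDeriv_smul {Φ : Plane → ℝ} (hΦ : Q.IsSmooth Φ) (c : ℝ)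
    (a b : Fin 2) (i : Fin 4) :
    Q.partialDeriv a (Q.partialDeriv b (c • Φ)) (Q.vertex i) =
      c * Q.partialDeriv a (Q.partialDeriv b Φ) (Q.vertex i) := by
  have hv := Q.vertex_mem i
  have hsmul : Q.IsSmooth (c • Φ) := ⟨hΦ.1.const_smul c, fun i => (hΦ.2 i).const_smul c⟩
  have h := ((hΦ.differentiableWithinAt_fderivWithin i).hasFDerivWithinAt.const_smul c).congr
    (fun z hz => ((hΦ.hasFDerivWithinAt hz).const_smul c).fderivWithin
      (Q.uniqueDiffOn_closedSet z hz))
    (((hΦ.hasFDerivWithinAt hv).const_smul c).fderivWithin (Q.uniqueDiffOn_closedSet _ hv))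
  rw [hΦ.partialDeriv_partialDeriv, hsmul.partialDeriv_partialDeriv,
    hess, h.fderivWithin (Q.uniqueDiffOn_closedSet _ hv)]
  rfl

/-- The local space as a submodule. -/
def localSubmodule (Q : Quadrilateral) (n : Fin 4 → Plane) {p k : ℕ} (hp : 3 ≤ p) (hk : 0 < k) :
    Submodule ℝ (Q.closedSet → ℝ) where
  carrier := Q.localSpace n p k
  add_mem' := by
    intro φ ψ hφ hψ
    have hφ' := isSmooth_of_mem hp hk hφ
    have hψ' := isSmooth_of_mem hp hk hψ
    obtain ⟨⟨s, hs, h1⟩, h2⟩ := hφ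
    obtain ⟨⟨t, ht, h3⟩, h4⟩ := hψ
    refine ⟨⟨s + t, Submodule.add_mem _ hs ht, fun ξ hξ => ?_⟩, fun i => ⟨?_, ?_⟩⟩
    · simp [ext_add, h1 ξ hξ, h3 ξ hξ]
    · rw [ext_add]
      exact (splineSpace _ _ _).add_mem (h2 i).1 (h4 i).1
    · refine splineSpace_congr ((splineSpace _ _ _).add_mem (h2 i).2 (h4 i).2) fun x hx => ?_
      rw [ext_add, hφ'.dirDeriv_add hψ' _ (Q.edgeParam_mem i hx)]
      rfl
  zero_mem' := by
    refine ⟨⟨0, Submodule.zero_mem _, fun ξ hξ => by simp [ext_zero]⟩, fun i => ⟨?_, ?_⟩⟩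
    · simp only [ext_zero]
      exact (splineSpace _ _ _).zero_mem
    · simp only [ext_zero, dirDeriv, fderivWithin_zero]
      exact (splineSpace _ _ _).zero_mem
  smul_mem' := by
    intro c φ hφ
    have hφ' := isSmooth_of_mem hp hk hφ
    obtain ⟨⟨s, hs, h1⟩, h2⟩ := hφ
    refine ⟨⟨c • s, Submodule.smul_mem _ c hs, fun ξ hξ => ?_⟩, fun i => ⟨?_, ?_⟩⟩
    · simp [ext_smul, h1 ξ hξ]
    · rw [ext_smul]
      exact (splineSpace _ _ _).smul_mem c (h2 i).1
    · refine splineSpace_congr ((splineSpace _ _ _).smul_mem c (h2 i).2) fun x hx => ?_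
      rw [ext_smul, hφ'.dirDeriv_smul c _ (Q.edgeParam_mem i hx)]
      rfl

/-- The degrees of freedom as a linear map. -/
noncomputable def dofMap (Q : Quadrilateral) (n : Fin 4 → Plane) {p k : ℕ} (hp : 3 ≤ p)
    (hk : 0 < k) : Q.localSubmodule n hp hk →ₗ[ℝ] (Dof p k → ℝ) where
  toFun φ := Q.dofValue n (φ : Q.closedSet → ℝ)
  map_add' := by
    rintro ⟨φ, hφ⟩ ⟨ψ, hψ⟩
    have hφ' := isSmooth_of_mem hp hk hφ
    have hψ' := isSmooth_of_mem hp hk hψ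
    funext d
    rcases d with ⟨i, m⟩ | ⟨i, j⟩ | ⟨i, j⟩ | ⟨j₁, j₂⟩
    · fin_cases m <;> simp only [AddMemClass.mk_add_mk, dofValue, ext_add,
        Pi.add_apply, Fin.mk_zero, Fin.mk_one, Fin.reduceFinMk, Matrix.cons_val]
      · exact hφ'.dirDeriv_add hψ' _ (Q.vertex_mem i)
      · exact hφ'.dirDeriv_add hψ' _ (Q.vertex_mem i)
      · exact hφ'.partialDeriv_partialDeriv_add hψ' _ _ i
      · exact hφ'.partialDeriv_partialDeriv_add hψ' _ _ i
      · exact hφ'.partialDeriv_partialDeriv_add hψ' _ _ i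
    · simp [dofValue, ext_add]
    · simp only [AddMemClass.mk_add_mk, dofValue, ext_add, Pi.add_apply]
      exact hφ'.dirDeriv_add hψ' _ (Q.edgeParam_mem i greville_mem)
    · simp [dofValue, ext_add]
  map_smul' := by
    rintro c ⟨φ, hφ⟩
    have hφ' := isSmooth_of_mem hp hk hφ
    funext d
    rcases d with ⟨i, m⟩ | ⟨i, j⟩ | ⟨i, j⟩ | ⟨j₁, j₂⟩
    · fin_cases m <;> simp only [SetLike.mk_smul_mk, dofValue, ext_smul, Pi.smul_apply,
        Fin.mk_zero, Fin.mk_one, Fin.reduceFinMk, Matrix.cons_val, RingHom.id_apply, smul_eq_mul]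
      · exact hφ'.dirDeriv_smul c _ (Q.vertex_mem i)
      · exact hφ'.dirDeriv_smul c _ (Q.vertex_mem i)
      · exact hφ'.partialDeriv_partialDeriv_smul c _ _ i
      · exact hφ'.partialDeriv_partialDeriv_smul c _ _ i
      · exact hφ'.partialDeriv_partialDeriv_smul c _ _ i
    · simp [dofValue, ext_smul]
    · simp only [SetLike.mk_smul_mk, dofValue, ext_smul, Pi.smul_apply, RingHom.id_apply,
        smul_eq_mul]
      exact hφ'.dirDeriv_smul c _ (Q.edgeParam_mem i greville_mem)
    · simp [dofValue, ext_smul]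

/-! ### Unisolvence -/

/-- The traces and normal derivatives of a function of the local space match its two-jets. -/
theorem edgeData_of_mem (hp : 3 ≤ p) (hk : 0 < k) {φ : Q.closedSet → ℝ}
    (hφ : φ ∈ Q.localSpace n p k) :
    EdgeData Q n p k (fun i => Q.jet (Q.ext φ) (Q.vertex i))
      (fun i t => Q.ext φ (Q.edgeParam i t))
      (fun i t => Q.dirDeriv (n i) (Q.ext φ) (Q.edgeParam i t)) := by
  have hs := isSmooth_of_mem hp hk hφ
  have h0 : (0 : ℝ) ∈ Icc (0 : ℝ) 1 := ⟨le_rfl, zero_le_one⟩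
  have h1 : (1 : ℝ) ∈ Icc (0 : ℝ) 1 := ⟨zero_le_one, le_rfl⟩
  refine ⟨fun i => (hφ.2 i).1, fun i => (hφ.2 i).2, fun i => ?_, fun i => ?_, fun i => ?_,
    fun i => ?_, fun i => ?_, fun i => ?_, fun i => ?_, fun i => ?_, fun i => ?_, fun i => ?_⟩
  · simp [jet, edgeParam_zero]
  · simp [jet, edgeParam_one]
  · rw [hs.derivWithin_edge i h0, edgeParam_zero, dirDeriv_eq_jetLin]
  · rw [hs.derivWithin_edge i h1, edgeParam_one, dirDeriv_eq_jetLin]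
  · rw [hs.iteratedDerivWithin_two_edge h0 (Q.edgeParam_zero i), hs.hess_eq_jetQuad]
  · rw [hs.iteratedDerivWithin_two_edge h1 (Q.edgeParam_one i), hs.hess_eq_jetQuad]
  · rw [edgeParam_zero, dirDeriv_eq_jetLin]
  · rw [edgeParam_one, dirDeriv_eq_jetLin]
  · rw [hs.derivWithin_dirDeriv_edge _ h0 (Q.edgeParam_zero i), hs.hess_eq_jetQuad]
  · rw [hs.derivWithin_dirDeriv_edge _ h1 (Q.edgeParam_one i), hs.hess_eq_jetQuad]

theorem jetLin_zero (u : Plane) : jetLin 0 u = 0 := by simp [jetLin]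

theorem jetQuad_zero (u w : Plane) : jetQuad 0 u w = 0 := by simp [jetQuad]

/-- Edge data are determined by the two-jets and the interior interpolation values. -/
theorem EdgeData.eq_zero {f g : Fin 4 → ℝ → ℝ} (h : EdgeData Q n p k 0 f g) (hp : 3 ≤ p)
    (hk : 0 < k) (hf : ∀ i (j : Fin (k + p - 6)), f i (eta p k (j + 3)) = 0)
    (hg : ∀ i (j : Fin (k + p - 5)), g i (eta (p - 1) k (j + 2)) = 0) (i : Fin 4) :
    (∀ t ∈ Icc (0 : ℝ) 1, f i t = 0) ∧ ∀ t ∈ Icc (0 : ℝ) 1, g i t = 0 := by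
  constructor
  · refine spline_eq_zero (μ := 1) (m := 3) hk le_rfl (by omega) (by omega) (by omega) (by omega)
      (h.trace_mem i) ?_ ?_ ?_
    · intro l hl
      interval_cases l
      · simpa using h.trace_zero i
      · simpa [iteratedDerivWithin_one, jetLin_zero] using h.deriv_trace_zero i
      · simpa [jetQuad_zero] using h.deriv2_trace_zero i
    · intro l hl
      interval_cases l
      · simpa using h.trace_one i
      · simpa [iteratedDerivWithin_one, jetLin_zero] using h.deriv_trace_one i
      · simpa [jetQuad_zero] using h.deriv2_trace_one i
    · intro j h1 h2
      simpa [eta, Nat.sub_add_cancel h1] using hf i ⟨j - 3, by omega⟩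
  · refine spline_eq_zero (μ := 1) (m := 2) hk le_rfl (by omega) (by omega) (by omega) (by omega)
      (h.normal_mem i) ?_ ?_ ?_
    · intro l hl
      interval_cases l
      · simpa [jetLin_zero] using h.normal_zero i
      · simpa [iteratedDerivWithin_one, jetQuad_zero] using h.deriv_normal_zero i
    · intro l hl
      interval_cases l
      · simpa [jetLin_zero] using h.normal_one i
      · simpa [iteratedDerivWithin_one, jetQuad_zero] using h.deriv_normal_one i
    · intro j h1 h2
      simpa [eta, Nat.sub_add_cancel h1] using hg i ⟨j - 2, by omega⟩

/-- Vertex and edge data annihilate traces and normal derivatives, Cramer's rule the cross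
derivatives, and the face values then the pullback. -/
theorem eq_zero_of_dofValue_eq_zero (hp : 3 ≤ p) (hk : 0 < k) (hn : Q.IsUnitNormals n)
    {φ : Q.closedSet → ℝ} (hφ : φ ∈ Q.localSpace n p k)
    (h : ∀ d : Dof p k, Q.dofValue n φ d = 0) : φ = 0 := by
  have hs := isSmooth_of_mem hp hk hφ
  have hE := edgeData_of_mem hp hk hφ
  have hJ : (fun i => Q.jet (Q.ext φ) (Q.vertex i)) = 0 := by
    funext i m
    exact h (.vertex i m)
  rw [hJ] at hE
  have hz := hE.eq_zero hp hk (fun i j => h (.edgeValue i j)) fun i j => h (.edgeNormal i j)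
  have hcross : ∀ i, ∀ t ∈ Icc (0 : ℝ) 1,
      Q.dirDeriv (Q.crossVec i t) (Q.ext φ) (Q.edgeParam i t) = 0 := by
    intro i t ht
    have h1 := det₂_mul_dirDeriv (Q := Q) (Φ := Q.ext φ) i (n i) (Q.crossVec i t) (Q.edgeParam i t)
    have h2 : Q.dirDeriv (edgeVec Q.vertex i) (Q.ext φ) (Q.edgeParam i t) = 0 := by
      rw [← hs.derivWithin_edge i ht, derivWithin_congr (hz i).1 ((hz i).1 t ht)]
      simp
    rw [h2, (hz i).2 t ht] at h1
    simpa [hn.det₂_ne_zero i] using h1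
  obtain ⟨⟨s, hsS, hsφ⟩, -⟩ := hφ
  have hs0 : ∀ ξ ∈ unitSquare, s ξ = 0 := by
    refine tensor_eq_zero hp hk hsS (fun x hx b => ?_) (fun y hy a => ?_) fun i j => ?_
    · rw [hs.nodal_snd p k hsφ hx, (hz 0).1 x hx, (hz 2).1 _ (reflect_mem hx), hcross 0 x hx,
        hcross 2 _ (reflect_mem hx)]
      fin_cases b <;> simp
    · rw [hs.nodal_fst p k hsφ hy, (hz 3).1 _ (reflect_mem hy), (hz 1).1 y hy,
        hcross 3 _ (reflect_mem hy), hcross 1 y hy]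
      fin_cases a <;> simp
    · rw [← hsφ _ ⟨greville_mem, greville_mem⟩]
      exact h (.face i j)
  funext z
  rw [← ext_apply φ z.2, ← Q.param_invParam z.2, hsφ _ (Q.invParam_mem z.2),
    hs0 _ (Q.invParam_mem z.2)]
  rfl

/-- The interpolated edge data determine a pullback `s`; it remains to show that `s ∘ invParam` has
these traces, normal derivatives and jets. -/
theorem exists_dofValue_eq (hp : 3 ≤ p) (hk : 0 < k) (hpk : 6 ≤ p + k) (hn : Q.IsUnitNormals n)
    (δ : Dof p k → ℝ) :
    ∃ φ ∈ Q.localSpace n p k, Q.dofValue n φ = δ := by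
  have h0 : (0 : ℝ) ∈ Icc (0 : ℝ) 1 := ⟨le_rfl, zero_le_one⟩
  have h1 : (1 : ℝ) ∈ Icc (0 : ℝ) 1 := ⟨zero_le_one, le_rfl⟩
  obtain ⟨f, g, hE, hfa, hgb⟩ := exists_edgeData Q n hp hk hpk (fun i m => δ (.vertex i m))
    (fun i j => δ (.edgeValue i j)) (fun i j => δ (.edgeNormal i j))
  obtain ⟨s, hsS, hsX, hsY, hsc⟩ := hE.exists_tensor hp hk (by omega) hn
    (fun i j => δ (.face i j))
  obtain ⟨φ, hφdef⟩ : ∃ φ : Q.closedSet → ℝ, ∀ z, φ z = s (Q.invParam z) := ⟨_, fun _ => rfl⟩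
  have hpull : ∀ ξ ∈ unitSquare, Q.ext φ (Q.param ξ) = s ξ := fun ξ hξ => by
    rw [ext_apply φ (Q.mapsTo_param hξ), hφdef, Q.invParam_param hξ]
  have hs := Q.isSmooth_of_pullback hp hk hsS hpull
  have hX := fun x (hx : x ∈ Icc (0 : ℝ) 1) b =>
    (hs.nodal_snd p k hpull hx b).symm.trans (hsX x hx b)
  have hY := fun y (hy : y ∈ Icc (0 : ℝ) 1) a =>
    (hs.nodal_fst p k hpull hy a).symm.trans (hsY y hy a)
  have hf : ∀ i, ∀ t ∈ Icc (0 : ℝ) 1, Q.ext φ (Q.edgeParam i t) = f i t := by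
    intro i t ht
    fin_cases i
    · exact hX t ht 0
    · exact hY t ht 1
    · simpa using hX (1 - t) (reflect_mem ht) 1
    · simpa using hY (1 - t) (reflect_mem ht) 0
  have hcross : ∀ i, ∀ t ∈ Icc (0 : ℝ) 1,
      Q.dirDeriv (Q.crossVec i t) (Q.ext φ) (Q.edgeParam i t) = Q.crossFun n i (f i) (g i) t := by
    intro i t ht
    fin_cases i
    · exact hX t ht 2
    · exact neg_injective (hY t ht 3)
    · simpa using hX (1 - t) (reflect_mem ht) 3
    · simpa using hY (1 - t) (reflect_mem ht) 2
  -- Cramer's rule read backwards: the normal derivative is recovered from tangential and cross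
  -- derivative, since edge and cross direction are independent.
  have hg : ∀ i, ∀ t ∈ Icc (0 : ℝ) 1,
      Q.dirDeriv (n i) (Q.ext φ) (Q.edgeParam i t) = g i t := by
    intro i t ht
    have e1 := det₂_mul_dirDeriv (Q := Q) (Φ := Q.ext φ) i (n i) (Q.crossVec i t) (Q.edgeParam i t)
    rw [← hs.derivWithin_edge i ht, derivWithin_congr (hf i) (hf i t ht), hcross i t ht, crossFun,
      mul_div_cancel₀ _ (hn.det₂_ne_zero i)] at e1
    exact (mul_left_cancel₀ (Q.det₂_edge_crossVec_pos i ht).ne' (add_left_cancel e1)).symm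
  have hφ : φ ∈ Q.localSpace n p k := ⟨⟨s, hsS, hpull⟩, fun i =>
    ⟨splineSpace_congr (hE.trace_mem i) (hf i), splineSpace_congr (hE.normal_mem i) (hg i)⟩⟩
  have hE' := edgeData_of_mem hp hk hφ
  have hjet : ∀ i, Q.jet (Q.ext φ) (Q.vertex i) = fun m => δ (.vertex i m) := by
    intro i
    -- The vertex ends edge `j` and starts edge `j + 1`. Both traces and the normal derivative on
    -- edge `j + 1` provide the six equations of `jet_ext`.
    obtain ⟨j, rfl⟩ : ∃ j, i = j + 1 := ⟨i - 1, by simp⟩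
    have hdet : det₂ (edgeVec Q.vertex j) (edgeVec Q.vertex (j + 1)) ≠ 0 := by
      have := Q.convex_ccw (j + 1)
      rw [add_sub_cancel_right] at this
      exact this.ne'
    have hd : ∀ l, ∀ t ∈ Icc (0 : ℝ) 1, derivWithin (fun t => Q.ext φ (Q.edgeParam l t))
        (Icc 0 1) t = derivWithin (f l) (Icc 0 1) t := fun l t ht =>
      derivWithin_congr (hf l) (hf l t ht)
    have hd2 : ∀ l, ∀ t ∈ Icc (0 : ℝ) 1, iteratedDerivWithin 2
        (fun t => Q.ext φ (Q.edgeParam l t)) (Icc 0 1) t =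
          iteratedDerivWithin 2 (f l) (Icc 0 1) t := fun l t ht =>
      iteratedDerivWithin_congr (hf l) ht
    refine jet_ext (hn.det₂_ne_zero (j + 1)) hdet ?_ ?_ ?_ ?_ ?_ ?_
    · exact (hE'.trace_zero (j + 1)).symm.trans ((hf _ 0 h0).trans (hE.trace_zero (j + 1)))
    · exact (hE'.deriv_trace_zero (j + 1)).symm.trans
        ((hd _ 0 h0).trans (hE.deriv_trace_zero (j + 1)))
    · exact (hE'.deriv_trace_one j).symm.trans ((hd _ 1 h1).trans (hE.deriv_trace_one j))
    · exact (hE'.deriv2_trace_zero (j + 1)).symm.trans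
        ((hd2 _ 0 h0).trans (hE.deriv2_trace_zero (j + 1)))
    · exact (hE'.deriv2_trace_one j).symm.trans ((hd2 _ 1 h1).trans (hE.deriv2_trace_one j))
    · exact (hE'.deriv_normal_zero (j + 1)).symm.trans
        ((derivWithin_congr (hg _) (hg _ 0 h0)).trans (hE.deriv_normal_zero (j + 1)))
  refine ⟨φ, hφ, ?_⟩
  funext d
  rcases d with ⟨i, m⟩ | ⟨i, j⟩ | ⟨i, j⟩ | ⟨j₁, j₂⟩
  · exact congrFun (hjet i) m
  · exact (hf i _ greville_mem).trans (hfa i j)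
  · exact (hg i _ greville_mem).trans (hgb i j)
  · exact (hpull _ ⟨greville_mem, greville_mem⟩).trans (hsc j₁ j₂)

end Quadrilateral

end SplineElement

/-- Unisolvence: the local space is a linear space on which the degrees of freedom are linear
functionals, and every assignment of values to the degrees of freedom is attained by exactly one
function of the space. -/
theorem mainTheorem4 (p k : ℕ) (hp : 3 ≤ p) (hk : max 1 (6 - p) ≤ k)
    (Q : SplineElement.Quadrilateral) (n : Fin 4 → SplineElement.Plane)
    (hn : Q.IsUnitNormals n) :
    ∃ V : Submodule ℝ (Q.closedSet → ℝ), (V : Set (Q.closedSet → ℝ)) = Q.localSpace n p k ∧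
      ∃ L : V ≃ₗ[ℝ] (SplineElement.Dof p k → ℝ),
        ∀ (φ : V) (d : SplineElement.Dof p k), L φ d = Q.dofValue n (φ : Q.closedSet → ℝ) d := by
  have hk0 : 0 < k := (le_max_left 1 (6 - p)).trans hk
  have hpk : 6 ≤ p + k := by
    have := (le_max_right 1 (6 - p)).trans hk
    omega
  refine ⟨Q.localSubmodule n hp hk0, rfl, LinearEquiv.ofBijective (Q.dofMap n hp hk0) ⟨?_, ?_⟩,
    fun φ d => rfl⟩
  · rw [← LinearMap.ker_eq_bot, LinearMap.ker_eq_bot']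
    rintro ⟨φ, hφ⟩ h
    exact Subtype.ext (SplineElement.Quadrilateral.eq_zero_of_dofValue_eq_zero hp hk0 hn hφ
      fun d => congrFun h d)
  · intro δ
    obtain ⟨φ, hφ, h⟩ := SplineElement.Quadrilateral.exists_dofValue_eq hp hk0 hpk hn δ
    exact ⟨⟨φ, hφ⟩, h⟩
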